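/- All simplicial complexes are finite and contain the empty simplex $\hat 0=\emptyset$; a complex $\Delta$ is regarded as a poset under inclusion. The rank of a simplex $x$ is its number of vertices $|x|$, and the rank $n$ of $\Delta$ is the largest rank of a simplex, so $\dim\Delta=n-1$. Write $[x,\hat 1)=\{y\in\Delta: y\ge x\}$. A sheaf $F$ on $\Delta$ consists of real vector spaces $F_x$ ($x\in\Delta$) and linear restriction maps $\mathrm{res}^x_y:F_x\to F_y$ for $x>y$ with $\mathrm{res}^y_z\circ\mathrm{res}^x_y=\mathrm{res}^x_z$ for $x>y>z$; an isomorphism of sheaves is a family of linear isomorphisms of the stalks that commute with the restriction maps. The constant sheaf $\mathbb R_\Delta$ has all stalks $\mathbb R$ and all restriction maps the identity. If $S\subseteq\Delta$ contains $[y,x]$ whenever it contains $y<x$, then $F|_S$ is the sheaf obtained from $F$ by replacing the stalks outside $S$ by $0$; $\mathbb R_S$ stands for $\mathbb R_\Delta|_S$. The cellular complex $C^\bullet(F,\Delta)$ has terms $C^k=\bigoplus_{|x|=n-k}F_x$, its differentials being the sums of the restriction maps to the codimension-one faces with the signs of the simplicial chain complex, and $C^\bullet(F,S)=C^\bullet(F|_S,\Delta)$.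 The sheaf $F$ is Cohen–Macaulay if $H^i(C^\bullet(F,[x,\hat 1)))=0$ for all $x\in\Delta$ and all $i>0$. For a Cohen–Macaulay sheaf $F$, the dual sheaf $F^\vee$ has the stalks $F^\vee_x=H^0(C^\bullet(F,[x,\hat 1)))^*$, and its restriction maps are the duals of the maps $H^0(C^\bullet(F,[x,\hat 1)))\to H^0(C^\bullet(F,[y,\hat 1)))$, $x<y$, induced by the projection $F|_{[x,\hat 1)}\to F|_{[y,\hat 1)}$. A complex $\Delta$ of rank $n$ is Gorenstein (a real homology sphere of dimension $n-1$) if for every $x\in\Delta$ (including $x=\emptyset$, whose link is $\Delta$) the reduced simplicial homology $\widetilde H_i(\mathrm{Link}_\Delta(x),\mathbb R)$ is $\mathbb R$ for $i=n-|x|-1$ and $0$ for all other $i$. For a complex $\Delta$ of rank $n$ and a subcomplex $\partial\Delta\subset\Delta$, the pair $(\Delta,\partial\Delta)$ is near-Gorenstein (a real homology ball with boundary $\partial\Delta$) if $\partial\Delta$ is Gorenstein of dimension $n-2$ and, for every $x\in\Delta$ (including $x=\emptyset$), $\widetilde H_i(\mathrm{Link}_\Delta(x),\mathbb R)$ is $\mathbb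 R$ if $i=n-|x|-1$ and $x\notin\partial\Delta$, and $0$ in all other cases. Theorem. Let $\Delta$ be a simplicial complex of rank $n$. (1) $\Delta$ is Gorenstein if and only if $\mathbb R_\Delta$ is Cohen–Macaulay and $\mathbb R_\Delta^\vee\simeq\mathbb R_\Delta$. (2) Let $\partial\Delta\subset\Delta$ be a subcomplex of rank $n-1$. Then $(\Delta,\partial\Delta)$ is near-Gorenstein if and only if $\mathbb R_\Delta$ is Cohen–Macaulay and $\mathbb R_\Delta^\vee\simeq\mathbb R_{\mathrm{Int}(\Delta)}$, where $\mathrm{Int}(\Delta)=\Delta\smallsetminus\partial\Delta$. -/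

import Mathlib

/-! ### Sheaves on posets -/

/-- A sheaf on a poset `P`: a real vector space (the stalk) for every element, and linear
restriction maps from the stalk at the larger element to the stalk at the smaller one. -/
structure PosetSheaf.{w, v} (P : Type v) [PartialOrder P] : Type (max v (w + 1)) where
  stalk : P → Type w
  [addCommGroup : ∀ p, AddCommGroup (stalk p)]
  [module : ∀ p, Module ℝ (stalk p)]
  res : ∀ {p q : P}, q ≤ p → (stalk p →ₗ[ℝ] stalk q)
  res_refl : ∀ (p : P) (a : stalk p), res (le_refl p) a = a
  res_res : ∀ {p q r : P} (hqp : q ≤ p) (hrq : r ≤ q) (a : stalk p),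
    res hrq (res hqp a) = res (hrq.trans hqp) a

namespace PosetSheaf

attribute [instance] PosetSheaf.addCommGroup PosetSheaf.module

variable {P : Type*} [PartialOrder P]

/-- A map of sheaves: linear maps on stalks that commute with the restriction maps. -/
structure Hom (F G : PosetSheaf P) where
  app : ∀ p, F.stalk p →ₗ[ℝ] G.stalk p
  comm : ∀ {p q : P} (h : q ≤ p) (a : F.stalk p), app q (F.res h a) = G.res h (app p a)

/-- An isomorphism of sheaves: linear isomorphisms on stalks that commute with the restriction
maps. -/
structure Iso (F G : PosetSheaf P) where
  app : ∀ p, F.stalk p ≃ₗ[ℝ] G.stalk p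
  comm : ∀ {p q : P} (h : q ≤ p) (a : F.stalk p), app q (F.res h a) = G.res h (app p a)

variable (P) in
/-- The constant sheaf `ℝ_P`: all stalks are `ℝ`, all restriction maps are the identity. -/
abbrev const : PosetSheaf P where
  stalk _ := ℝ
  res _ := LinearMap.id
  res_refl _ _ := rfl
  res_res _ _ _ := rfl

/-- The subspace of the stalk of `F` at `p` which is everything if `p ∈ S` and zero if not. -/
def stalkOn (F : PosetSheaf P) (S : Set P) (p : P) : Submodule ℝ (F.stalk p) where
  carrier := {a | p ∉ S → a = 0}
  add_mem' ha hb h := by rw [ha h, hb h, add_zero]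
  zero_mem' _ := rfl
  smul_mem' c a ha h := by rw [ha h, smul_zero]

open Classical in
/-- The restriction map of `F|_S`: that of `F` between two elements of `S`, and zero otherwise
(if `p ∉ S` and `q ∈ S`, then its source is zero). -/
noncomputable def resOn (F : PosetSheaf P) (S : Set P) {p q : P} (h : q ≤ p) :
    F.stalkOn S p →ₗ[ℝ] F.stalkOn S q :=
  if hq : q ∈ S then
    ((F.res h).comp (F.stalkOn S p).subtype).codRestrict (F.stalkOn S q)
      (fun _ hn => absurd hq hn)
  else 0

theorem coe_resOn_of_mem (F : PosetSheaf P) (S : Set P) {p q : P} (h : q ≤ p) (hq : q ∈ S)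
    (a : F.stalkOn S p) : (F.resOn S h a : F.stalk q) = F.res h a := by
  rw [resOn, dif_pos hq]; rfl

theorem resOn_of_notMem (F : PosetSheaf P) (S : Set P) {p q : P} (h : q ≤ p) (hq : q ∉ S)
    (a : F.stalkOn S p) : F.resOn S h a = 0 := by
  simp [resOn, hq]

/-- The sheaf `F|_S`, for a subset `S` that contains `[q, p]` whenever it contains `q` and `p`:
the stalks outside `S` are replaced by zero. -/
noncomputable abbrev restrict (F : PosetSheaf P) (S : Set P) [hS : S.OrdConnected] :
    PosetSheaf P where
  stalk p := F.stalkOn S p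
  res h := F.resOn S h
  res_refl p a := by
    by_cases hp : p ∈ S
    · exact Subtype.ext ((F.coe_resOn_of_mem S _ hp a).trans (F.res_refl p _))
    · have ha : a = 0 := Subtype.ext (a.2 hp)
      rw [ha, map_zero]
  res_res {p q r} hqp hrq a := by
    by_cases hp : p ∈ S
    · by_cases hr : r ∈ S
      · have hq : q ∈ S := hS.out hr hp ⟨hrq, hqp⟩
        apply Subtype.ext
        rw [coe_resOn_of_mem _ _ _ hr, coe_resOn_of_mem _ _ _ hq, coe_resOn_of_mem _ _ _ hr,
          F.res_res]
      · rw [resOn_of_notMem _ _ _ hr, resOn_of_notMem _ _ _ hr]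
    · have ha : a = 0 := Subtype.ext (a.2 hp)
      rw [ha, map_zero, map_zero, map_zero]

open Classical in
/-- On the stalks at `p`, the projection `F|_{[x,1̂)} → F|_{[y,1̂)}` for `x ≤ y`: the identity if
`y ≤ p`, and zero otherwise. -/
noncomputable def projOn (F : PosetSheaf P) {x y : P} (_hxy : x ≤ y) (p : P) :
    F.stalkOn (Set.Ici x) p →ₗ[ℝ] F.stalkOn (Set.Ici y) p :=
  if hp : y ≤ p then
    Submodule.inclusion (fun _ _ hn => absurd hp hn)
  else 0

theorem coe_projOn_of_le (F : PosetSheaf P) {x y : P} (hxy : x ≤ y) {p : P} (hp : y ≤ p)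
    (a : F.stalkOn (Set.Ici x) p) : (F.projOn hxy p a : F.stalk p) = a := by
  rw [projOn, dif_pos hp]; rfl

theorem projOn_of_not_le (F : PosetSheaf P) {x y : P} (hxy : x ≤ y) {p : P} (hp : ¬ y ≤ p)
    (a : F.stalkOn (Set.Ici x) p) : F.projOn hxy p a = 0 := by
  simp [projOn, hp]

/-- The projection map of sheaves `F|_{[x,1̂)} → F|_{[y,1̂)}` for `x ≤ y`. -/
noncomputable def proj (F : PosetSheaf P) {x y : P} (hxy : x ≤ y) :
    Hom (F.restrict (Set.Ici x)) (F.restrict (Set.Ici y)) where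
  app p := F.projOn hxy p
  comm {p q} h a := by
    change F.projOn hxy q (F.resOn _ h a) = F.resOn _ h (F.projOn hxy p a)
    by_cases hq : y ≤ q
    · apply Subtype.ext
      rw [coe_projOn_of_le _ _ hq, coe_resOn_of_mem _ _ _ (show q ∈ Set.Ici y from hq),
        coe_projOn_of_le _ _ (hq.trans h),
        coe_resOn_of_mem _ _ _ (show q ∈ Set.Ici x from hxy.trans hq)]
    · rw [projOn_of_not_le _ _ hq, resOn_of_notMem _ _ _ (show q ∉ Set.Ici y from hq)]

end PosetSheaf

/-! ### Simplicial complexes -/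

/-- The sign of the facet `y` in the boundary of the simplex `x = {v₀ < ⋯ < v_m}`: it is `(-1)^j`
if `y = x \ {v_j}` (the product then has the single factor `v = v_j`). -/
def simplexSign {V : Type*} [LinearOrder V] (x y : Finset V) : ℝ :=
  ∏ v ∈ x \ y, (-1) ^ (x.filter (· < v)).card

namespace PreAbstractSimplicialComplex

variable {V : Type*}

/-- The simplices of `Δ`, ordered by inclusion, including the empty simplex `0̂ = ∅` (which is
not among the `faces`, by the convention of Mathlib). -/
abbrev Simplex (Δ : PreAbstractSimplicialComplex V) : Type _ :=
  {s : Finset V // s = ∅ ∨ s ∈ Δ.faces}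

/-- The link of a simplex `x`: all `t` disjoint from `x` such that `t ∪ x` is a simplex. -/
def link [DecidableEq V] (Δ : PreAbstractSimplicialComplex V) (x : Finset V) :
    PreAbstractSimplicialComplex V where
  faces := {t | t.Nonempty ∧ Disjoint t x ∧ t ∪ x ∈ Δ.faces}
  isRelLowerSet_faces := by
    rintro t ⟨hne, hd, ht⟩
    refine ⟨hne, fun s hs hsne => ⟨hsne, Finset.disjoint_of_subset_left hs hd, ?_⟩⟩
    exact (Δ.isRelLowerSet_faces ht).2 (Finset.union_subset_union_left hs)
      (hsne.mono Finset.subset_union_left)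

/-- `Int Δ = Δ \ D`, as a set of simplices of `Δ` (with `∅ ∈ D` for every complex `D`). -/
def interior (Δ D : PreAbstractSimplicialComplex V) : Set Δ.Simplex :=
  {x | ¬ (x.1 = ∅ ∨ x.1 ∈ D.faces)}

instance (Δ D : PreAbstractSimplicialComplex V) : (Δ.interior D).OrdConnected := by
  refine ⟨fun x hx y _ z hz hzD => hx ?_⟩
  have hxz : x.1 ⊆ z.1 := hz.1
  rcases x.1.eq_empty_or_nonempty with h | h
  · exact Or.inl h
  · rcases hzD with hz0 | hzD
    · rw [hz0] at hxz
      exact Or.inl (Finset.subset_empty.mp hxz)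
    · exact Or.inr ((D.isRelLowerSet_faces hzD).2 hxz h)

variable [Fintype V]

noncomputable instance (Δ : PreAbstractSimplicialComplex V) : Fintype Δ.Simplex :=
  Fintype.ofFinite _

/-- The rank `n` of `Δ`: the largest number of vertices of a simplex. The dimension is `n - 1`. -/
noncomputable def rank (Δ : PreAbstractSimplicialComplex V) : ℕ :=
  Finset.univ.sup fun x : Δ.Simplex => x.1.card

/-- The simplices of dimension `i`, i.e. with `i + 1` vertices (only `∅` for `i = -1`). -/
abbrev SimplexOfDim (Δ : PreAbstractSimplicialComplex V) (i : ℤ) : Type _ :=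
  {x : Δ.Simplex // (x.1.card : ℤ) = i + 1}

noncomputable instance (Δ : PreAbstractSimplicialComplex V) (i : ℤ) :
    Fintype (Δ.SimplexOfDim i) :=
  Fintype.ofFinite _

variable [LinearOrder V]

/-! #### Reduced simplicial homology -/

/-- The augmented simplicial chain complex in degree `i`, with real coefficients. -/
abbrev Chain (Δ : PreAbstractSimplicialComplex V) (i : ℤ) : Type _ :=
  Δ.SimplexOfDim i → ℝ

/-- The boundary map from `i`-chains to `j`-chains, of interest for `j = i - 1` and zero
otherwise. -/
noncomputable def boundary (Δ : PreAbstractSimplicialComplex V) (i j : ℤ) :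
    Δ.Chain i →ₗ[ℝ] Δ.Chain j :=
  LinearMap.pi fun y =>
    ∑ x : Δ.SimplexOfDim i,
      if y.1 ≤ x.1 ∧ x.1.1.card = y.1.1.card + 1 then
        simplexSign x.1.1 y.1.1 • LinearMap.proj x
      else 0

/-- The reduced simplicial homology `H̃_i(Δ, ℝ)`: cycles modulo boundaries. -/
abbrev ReducedHomology (Δ : PreAbstractSimplicialComplex V) (i : ℤ) : Type _ :=
  (Δ.boundary i (i - 1)).ker ⧸
    (Δ.boundary (i + 1) i).range.submoduleOf (Δ.boundary i (i - 1)).ker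

/-- `Δ` is Gorenstein, i.e. a real homology sphere of dimension `n - 1` where `n = rank Δ`: for
every simplex `x`, including `x = ∅` with `Link ∅ = Δ`, the reduced homology of the link of `x` is
`ℝ` in degree `n - |x| - 1 = (n - 1) - dim x - 1` and zero in all other degrees. -/
def IsGorenstein (Δ : PreAbstractSimplicialComplex V) : Prop :=
  ∀ (x : Δ.Simplex) (i : ℤ),
    if i = (Δ.rank : ℤ) - x.1.card - 1 then
      Nonempty ((Δ.link x.1).ReducedHomology i ≃ₗ[ℝ] ℝ)
    else Subsingleton ((Δ.link x.1).ReducedHomology i)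

open Classical in
/-- The pair `(Δ, D)` is near-Gorenstein, i.e. `Δ` is a real homology ball of dimension `n - 1`
with boundary `D`, where `n = rank Δ`: the subcomplex `D` is Gorenstein of dimension `n - 2`, and
for every simplex `x` of `Δ`, including `x = ∅`, the reduced homology of the link of `x` is `ℝ` in
degree `n - |x| - 1` if `x ∉ D`, and zero in all other cases. -/
def IsNearGorenstein (Δ D : PreAbstractSimplicialComplex V) : Prop :=
  D ≤ Δ ∧ (D.rank + 1 = Δ.rank ∧ D.IsGorenstein) ∧
    ∀ (x : Δ.Simplex) (i : ℤ),
      if i = (Δ.rank : ℤ) - x.1.card - 1 ∧ x ∈ Δ.interior D then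
        Nonempty ((Δ.link x.1).ReducedHomology i ≃ₗ[ℝ] ℝ)
      else Subsingleton ((Δ.link x.1).ReducedHomology i)

end PreAbstractSimplicialComplex

/-! ### The cellular complex of a sheaf on a simplicial complex, and the dual sheaf -/

namespace PosetSheaf

variable {V : Type*} [Fintype V] {Δ : PreAbstractSimplicialComplex V}

/-- The simplices `x` with `n - k` vertices, where `n = rank Δ`; they index `C^k`. -/
abbrev _root_.PreAbstractSimplicialComplex.SimplexOfCodeg (Δ : PreAbstractSimplicialComplex V)
    (k : ℤ) : Type _ :=
  {x : Δ.Simplex // (x.1.card : ℤ) = Δ.rank - k}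

noncomputable instance (k : ℤ) : Fintype (Δ.SimplexOfCodeg k) :=
  Fintype.ofFinite _

/-- The term `C^k(F, Δ) = ⨁_{rank x = n - k} F_x` of the cellular complex. -/
abbrev Cochain (F : PosetSheaf Δ.Simplex) (k : ℤ) : Type _ :=
  ∀ x : Δ.SimplexOfCodeg k, F.stalk x.1

open Classical in
/-- The differential `C^k → C^l` of the cellular complex, of interest for `l = k + 1` and zero
otherwise: the sum of the restriction maps `F_x → F_y` over all facets `y` of `x`, with the signs
of the simplicial chain complex. -/
noncomputable def differential [LinearOrder V] (F : PosetSheaf Δ.Simplex) (k l : ℤ) :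
    F.Cochain k →ₗ[ℝ] F.Cochain l :=
  LinearMap.pi fun y =>
    ∑ x : Δ.SimplexOfCodeg k,
      if h : y.1 ≤ x.1 ∧ x.1.1.card = y.1.1.card + 1 then
        simplexSign x.1.1 y.1.1 • (F.res h.1).comp (LinearMap.proj x)
      else 0

/-- The map of cellular complexes induced by a map of sheaves, in degree `k`. -/
def cochainMap {F G : PosetSheaf Δ.Simplex} (φ : Hom F G) (k : ℤ) :
    F.Cochain k →ₗ[ℝ] G.Cochain k :=
  LinearMap.pi fun x => (φ.app x.1).comp (LinearMap.proj x)

theorem cochainMap_apply {F G : PosetSheaf Δ.Simplex} (φ : Hom F G) (k : ℤ) (f : F.Cochain k)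
    (x : Δ.SimplexOfCodeg k) : cochainMap φ k f x = φ.app x.1 (f x) := rfl

variable [LinearOrder V]

theorem differential_apply (F : PosetSheaf Δ.Simplex) (k l : ℤ) (f : F.Cochain k)
    (y : Δ.SimplexOfCodeg l) :
    F.differential k l f y = ∑ x : Δ.SimplexOfCodeg k,
      if h : y.1 ≤ x.1 ∧ x.1.1.card = y.1.1.card + 1 then
        simplexSign x.1.1 y.1.1 • F.res h.1 (f x)
      else 0 := by
  simp only [differential, LinearMap.pi_apply, LinearMap.sum_apply]
  refine Finset.sum_congr rfl fun x _ => ?_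
  split_ifs <;> simp

theorem cochainMap_differential {F G : PosetSheaf Δ.Simplex} (φ : Hom F G) (k l : ℤ)
    (f : F.Cochain k) :
    cochainMap φ l (F.differential k l f) = G.differential k l (cochainMap φ k f) := by
  funext y
  rw [cochainMap_apply, differential_apply, differential_apply, map_sum]
  refine Finset.sum_congr rfl fun x _ => ?_
  split_ifs with h
  · rw [map_smul, φ.comm, cochainMap_apply]
  · rw [map_zero]

/-- The cohomology `H^k(C^•(F, Δ))` of the cellular complex. -/
abbrev Cohomology (F : PosetSheaf Δ.Simplex) (k : ℤ) : Type _ :=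
  (F.differential k (k + 1)).ker ⧸
    (F.differential (k - 1) k).range.submoduleOf (F.differential k (k + 1)).ker

/-- The map on cocycles induced by a map of sheaves. -/
noncomputable def cocycleMap {F G : PosetSheaf Δ.Simplex} (φ : Hom F G) (k : ℤ) :
    (F.differential k (k + 1)).ker →ₗ[ℝ] (G.differential k (k + 1)).ker :=
  (cochainMap φ k).restrict fun f hf => by
    rw [LinearMap.mem_ker] at hf ⊢
    rw [← cochainMap_differential, hf, map_zero]

/-- The map on cohomology induced by a map of sheaves. -/
noncomputable def cohomologyMap {F G : PosetSheaf Δ.Simplex} (φ : Hom F G) (k : ℤ) :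
    F.Cohomology k →ₗ[ℝ] G.Cohomology k :=
  Submodule.mapQ _ _ (cocycleMap φ k) <| by
    rintro ⟨f, hf⟩ ⟨g, hg⟩
    exact ⟨cochainMap φ (k - 1) g,
      (cochainMap_differential φ (k - 1) k g).symm.trans (congrArg (cochainMap φ k) hg)⟩

/-- `F` is Cohen–Macaulay if `H^i(C^•(F, [x,1̂))) = 0` for all `x ∈ Δ` and `i > 0`, where
`C^•(F, S)` stands for `C^•(F|_S, Δ)`. -/
def IsCohenMacaulay (F : PosetSheaf Δ.Simplex) : Prop :=
  ∀ (x : Δ.Simplex) (i : ℤ), 0 < i → Subsingleton ((F.restrict (Set.Ici x)).Cohomology i)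

/-- The map `H^0(C^•(F, [x,1̂))) → H^0(C^•(F, [y,1̂)))` induced by the projection, for `x ≤ y`. -/
noncomputable def projH (F : PosetSheaf Δ.Simplex) {x y : Δ.Simplex} (hxy : x ≤ y) :
    (F.restrict (Set.Ici x)).Cohomology 0 →ₗ[ℝ] (F.restrict (Set.Ici y)).Cohomology 0 :=
  cohomologyMap (F.proj hxy) 0

theorem projH_refl (F : PosetSheaf Δ.Simplex) (x : Δ.Simplex) :
    F.projH (le_refl x) = LinearMap.id := by
  refine LinearMap.ext fun a => ?_
  obtain ⟨f, rfl⟩ := Submodule.Quotient.mk_surjective _ a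
  refine congrArg Submodule.Quotient.mk (Subtype.ext (funext fun p => ?_))
  change F.projOn (le_refl x) p.1 (f.1 p) = f.1 p
  by_cases hp : x ≤ p.1
  · exact Subtype.ext (F.coe_projOn_of_le _ hp _)
  · rw [projOn_of_not_le _ _ hp]
    exact Subtype.ext (Eq.symm ((f.1 p).2 hp))

theorem projH_projH (F : PosetSheaf Δ.Simplex) {x y z : Δ.Simplex} (hxy : x ≤ y) (hyz : y ≤ z) :
    (F.projH hyz).comp (F.projH hxy) = F.projH (hxy.trans hyz) := by
  refine LinearMap.ext fun a => ?_
  obtain ⟨f, rfl⟩ := Submodule.Quotient.mk_surjective _ a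
  refine congrArg Submodule.Quotient.mk (Subtype.ext (funext fun p => ?_))
  change F.projOn hyz p.1 (F.projOn hxy p.1 (f.1 p)) = F.projOn (hxy.trans hyz) p.1 (f.1 p)
  by_cases hp : z ≤ p.1
  · apply Subtype.ext
    rw [coe_projOn_of_le _ _ hp, coe_projOn_of_le _ _ (hyz.trans hp), coe_projOn_of_le _ _ hp]
  · rw [projOn_of_not_le _ _ hp,
      projOn_of_not_le _ _ hp]

/-- The dual sheaf `F^∨`, with stalks `F^∨_x = H^0(C^•(F, [x,1̂)))^*` and with the duals of the maps
`projH` as restriction maps. (It is considered only for Cohen–Macaulay `F`.) -/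
noncomputable abbrev dual (F : PosetSheaf Δ.Simplex) : PosetSheaf Δ.Simplex where
  stalk x := Module.Dual ℝ ((F.restrict (Set.Ici x)).Cohomology 0)
  res h := (F.projH h).dualMap
  res_refl x a := by
    rw [projH_refl]; rfl
  res_res hqp hrq a := by
    rw [← projH_projH F hrq hqp]; rfl

end PosetSheaf

/-! All complexes involved are realised inside the real functions on `Finset V`. Let K be the set of
simplices. Up to a sign twist and a degree shift, the chains of Link(x) are the chains on `K ∩
Set.Ici x` with boundary `bd`, and so is the cellular complex of ℝ on [x,1̂). Thus Cohen–Macaulay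
means `HasTopHomology`, and H^0 is the space Z_x of relative cycles of facets above x.

For upward closed S, an isomorphism from the dual sheaf to ℝ_S amounts to one chain ζ of facets
whose restriction above x spans Z_x for x ∈ S, while Z_x = 0 for x ∉ S (`IsFundamentalClass`).
Indeed the isomorphism at x is evaluation at an element of Z_x, and compatibility with restriction
glues these elements (`exists_isFundamentalClass_of_iso`, `nonempty_iso_of_isFundamentalClass`).

From homology to sheaves, ζ is a generator of Z_∅ for a sphere; for a ball it is a chain whose
boundary is the fundamental cycle of ∂Δ. It must not vanish above any simplex. This follows from
strong connectivity (`HasTopHomology.strongly_connected`), since being nonzero passes from a facet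
to its neighbours across ridges (`isFundamentalClass_of_generators`).

From sheaves to homology, the conditions on links are immediate; what remains is that ∂Δ is a
sphere. Duality (`IsFundamentalClass.exactAt`) shows that the interior part of [x,1̂) has homology
in top degree only, by a double complex of functions a(y,z) on pairs x ⊆ y ⊆ z: the rows are acyclic
intervals, and the columns are dual to the complexes above y. The long exact sequence of the
boundary, written out by hand, then gives the homology of ∂Δ, with ∂ζ as generator
(`boundary_exactAt`, `boundary_isGenerator`). -/

/-! ### The boundary operator on functions of finite sets -/

namespace SetChain

open Finset

section

variable {V : Type*} [LinearOrder V]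

/-- The sign `(-1)^j`, where `j` is the number of elements of `y` that are smaller than `v`. -/
def sg (v : V) (y : Finset V) : ℝ := (-1) ^ (y.filter (· < v)).card

theorem sg_mul_self (v : V) (y : Finset V) : sg v y * sg v y = 1 := by
  rw [sg, ← mul_pow]; norm_num

theorem sg_ne_zero (v : V) (y : Finset V) : sg v y ≠ 0 := by
  intro h; simpa [h] using sg_mul_self v y

theorem sg_insert {v w : V} {y : Finset V} (hw : w ∉ y) :
    sg v (insert w y) = (if w < v then -1 else 1) * sg v y := by
  unfold sg
  rw [filter_insert]
  split_ifs with h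
  · rw [card_insert_of_notMem (by simp [hw]), pow_succ]; ring
  · rw [one_mul]

theorem sg_insert_self {v : V} {y : Finset V} (hv : v ∉ y) : sg v (insert v y) = sg v y := by
  simp [sg_insert hv]

theorem sg_erase_self (v : V) (y : Finset V) : sg v (y.erase v) = sg v y := by
  by_cases hv : v ∈ y
  · conv_rhs => rw [← insert_erase hv]
    rw [sg_insert_self (notMem_erase v y)]
  · rw [erase_eq_of_notMem hv]

/-- Exactly one of the two insertions moves the other vertex by one position. This is the source of
∂∂ = 0. -/
theorem sg_comm {v w : V} {y : Finset V} (hvw : v ≠ w) (hv : v ∉ y) (hw : w ∉ y) :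
    sg v (insert w y) * sg w y = -(sg w (insert v y) * sg v y) := by
  rw [sg_insert hw, sg_insert hv]
  rcases lt_or_gt_of_ne hvw with h | h
  · rw [if_neg h.not_gt, if_pos h]; ring
  · rw [if_pos h, if_neg h.not_gt]; ring

theorem sg_union {v : V} {x y : Finset V} (h : Disjoint x y) :
    sg v (x ∪ y) = sg v x * sg v y := by
  unfold sg
  rw [filter_union, card_union_of_disjoint (disjoint_filter_filter h), pow_add]

theorem simplexSign_insert {v : V} {y : Finset V} (hv : v ∉ y) :
    simplexSign (insert v y) y = sg v y := by
  have : insert v y \ y = {v} := by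
    ext u; simp only [mem_sdiff, mem_insert, mem_singleton]; grind
  rw [simplexSign, this, prod_singleton]
  exact sg_insert_self hv

/-- The simplicial coboundary operator on the functions of all finite sets. -/
def cobd : (Finset V → ℝ) →ₗ[ℝ] (Finset V → ℝ) where
  toFun f z := ∑ v ∈ z, sg v z * f (z.erase v)
  map_add' f g := by
    funext y; simp only [Pi.add_apply, mul_add, sum_add_distrib]
  map_smul' c f := by
    funext y
    simp only [Pi.smul_apply, smul_eq_mul, RingHom.id_apply, mul_sum]
    exact sum_congr rfl fun v _ => by ring

theorem cobd_apply (f : Finset V → ℝ) (z : Finset V) :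
    cobd f z = ∑ v ∈ z, sg v z * f (z.erase v) := rfl

theorem cobd_eq_zero {f : Finset V → ℝ} {z : Finset V} (h : ∀ v ∈ z, f (z.erase v) = 0) :
    cobd f z = 0 := by
  rw [cobd_apply]
  exact sum_eq_zero fun v hv => by rw [h v hv, mul_zero]

open Classical in
/-- The part of a function that lies on the sets containing `x`. -/
noncomputable def cut (x : Finset V) : (Finset V → ℝ) →ₗ[ℝ] (Finset V → ℝ) where
  toFun f y := if x ⊆ y then f y else 0
  map_add' f g := by funext y; by_cases h : x ⊆ y <;> simp [h]
  map_smul' c f := by funext y; by_cases h : x ⊆ y <;> simp [h]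

theorem cut_of_subset {x y : Finset V} (h : x ⊆ y) (f : Finset V → ℝ) : cut x f y = f y :=
  if_pos h

theorem cut_of_not_subset {x y : Finset V} (h : ¬ x ⊆ y) (f : Finset V → ℝ) : cut x f y = 0 :=
  if_neg h

theorem cut_cut {x y : Finset V} (h : x ⊆ y) (f : Finset V → ℝ) : cut y (cut x f) = cut y f := by
  funext z
  by_cases hz : y ⊆ z
  · rw [cut_of_subset hz, cut_of_subset hz, cut_of_subset (h.trans hz)]
  · rw [cut_of_not_subset hz, cut_of_not_subset hz]

end

variable {V : Type*} [Fintype V] [LinearOrder V]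

/-- The simplicial boundary operator on the functions of all finite sets. -/
def bd : (Finset V → ℝ) →ₗ[ℝ] (Finset V → ℝ) where
  toFun f y := ∑ v ∈ yᶜ, sg v y * f (insert v y)
  map_add' f g := by
    funext y; simp only [Pi.add_apply, mul_add, sum_add_distrib]
  map_smul' c f := by
    funext y
    simp only [Pi.smul_apply, smul_eq_mul, RingHom.id_apply, mul_sum]
    exact sum_congr rfl fun v _ => by ring

theorem bd_apply (f : Finset V → ℝ) (y : Finset V) :
    bd f y = ∑ v ∈ yᶜ, sg v y * f (insert v y) := rfl

theorem bd_eq_zero {f : Finset V → ℝ} {y : Finset V} (h : ∀ v ∉ y, f (insert v y) = 0) :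
    bd f y = 0 := by
  rw [bd_apply]
  exact sum_eq_zero fun v hv => by rw [h v (mem_compl.mp hv), mul_zero]

theorem sum_sum_insert_eq (F : V → Finset V → ℝ) :
    ∑ y : Finset V, ∑ v ∈ yᶜ, F v (insert v y) = ∑ z : Finset V, ∑ v ∈ z, F v z := by
  rw [sum_sigma', sum_sigma']
  refine sum_bij' (fun p _ => ⟨insert p.2 p.1, p.2⟩) (fun p _ => ⟨p.1.erase p.2, p.2⟩) ?_ ?_ ?_ ?_ ?_
  · rintro ⟨y, v⟩ -; simp
  · rintro ⟨y, v⟩ -; simp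
  · rintro ⟨y, v⟩ h; simp at h; simp [erase_insert h]
  · rintro ⟨y, v⟩ h; simp at h; simp [insert_erase h]
  · rintro ⟨y, v⟩ -; rfl

/-- Both sides sum over the incidences of a set with a facet, so `bd` and `cobd` are transposes of
each other. -/
theorem sum_mul_bd (f g : Finset V → ℝ) : ∑ y, g y * bd f y = ∑ z, cobd g z * f z := by
  have h := sum_sum_insert_eq fun (v : V) z => g (z.erase v) * (sg v (z.erase v) * f z)
  simp only [bd_apply, cobd_apply, mul_sum, sum_mul]
  calc _ = _ := sum_congr rfl fun y _ => sum_congr rfl fun v hv => by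
          rw [erase_insert (mem_compl.mp hv)]
    _ = _ := h
    _ = _ := sum_congr rfl fun z _ => sum_congr rfl fun v _ => by rw [sg_erase_self]; ring

/-- A sum of an antisymmetric function vanishes. -/
theorem sum_sum_antisymm {ι : Type*} (s : Finset ι) (F : ι → ι → ℝ)
    (h : ∀ v ∈ s, ∀ w ∈ s, F v w = -F w v) : ∑ v ∈ s, ∑ w ∈ s, F v w = 0 := by
  have h1 : ∑ v ∈ s, ∑ w ∈ s, F v w = -∑ v ∈ s, ∑ w ∈ s, F v w := by
    conv_rhs => rw [sum_comm]
    rw [← sum_neg_distrib]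
    refine sum_congr rfl fun v hv => ?_
    rw [← sum_neg_distrib]
    exact sum_congr rfl fun w hw => h v hv w hw
  linarith

/-- Expanding the boundary leaves a sum over pairs in `A`, antisymmetric by `sg_comm`; pairs leaving
`A` drop out by `hA`. For `A` everything this is ∂∂ = 0. For `A` a union of components of the graph
of `f` in the link of `x`, it says that a boundary has total weight zero on it. -/
theorem sum_bd_insert (f : Finset V → ℝ) (x : Finset V) (A : V → Prop) [DecidablePred A]
    (hA : ∀ v w, v ∉ x → w ∉ x → v ≠ w → A v → ¬ A w → f (insert w (insert v x)) = 0) :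
    ∑ v ∈ xᶜ with A v, sg v x * bd f (insert v x) = 0 := by
  have h := sum_sum_antisymm (xᶜ.filter A) (fun v w =>
    if v = w then 0 else sg v x * (sg w (insert v x) * f (insert w (insert v x)))) (by
      intro v hv w hw
      rw [mem_filter, mem_compl] at hv hw
      by_cases hvw : v = w
      · simp [hvw]
      · rw [if_neg hvw, if_neg (Ne.symm hvw), insert_comm]
        have := sg_comm hvw hv.1 hw.1
        linear_combination (f (insert v (insert w x))) * this)
  rw [← h]
  refine sum_congr rfl fun v hv => ?_
  rw [mem_filter, mem_compl] at hv
  rw [bd_apply, mul_sum]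
  have hsub : (xᶜ.filter A).erase v ⊆ (insert v x)ᶜ := by
    intro w; simp; tauto
  rw [← sum_subset hsub]
  · rw [← sum_erase (xᶜ.filter A) (a := v) (f := fun w => if v = w then 0 else
      sg v x * (sg w (insert v x) * f (insert w (insert v x)))) (if_pos rfl)]
    exact sum_congr rfl fun w hw => by rw [if_neg (Ne.symm (ne_of_mem_erase hw))]
  · intro w hw hw'
    simp only [compl_insert, mem_erase, mem_compl, mem_filter, not_and] at hw hw'
    rw [hA v w hv.1 hw.2 (Ne.symm hw.1) hv.2 (hw' hw.1 hw.2), mul_zero, mul_zero]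

theorem bd_bd (f : Finset V → ℝ) : bd (bd f) = 0 := by
  funext x
  have := sum_bd_insert f x (fun _ => True) (by simp)
  simpa [bd_apply (bd f)] using this

theorem cobd_cobd (f : Finset V → ℝ) : cobd (cobd f) = 0 := by
  funext z
  have h := sum_mul_bd (Pi.single z 1) (cobd f)
  rw [← sum_mul_bd, bd_bd] at h
  simpa [Pi.single_apply] using h.symm

theorem bd_cut {x y : Finset V} (h : x ⊆ y) (f : Finset V → ℝ) : bd (cut x f) y = bd f y := by
  simp only [bd_apply]
  exact sum_congr rfl fun v _ => by rw [cut_of_subset (h.trans (subset_insert v y))]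

/-- The interval `[x, z]` of finite sets is acyclic for `x ⊂ z`. -/
theorem exists_bd_eq_of_interval {x z : Finset V} (hxz : x ⊂ z) {f : Finset V → ℝ}
    (hf : ∀ y, ¬ (x ⊆ y ∧ y ⊆ z) → f y = 0) (hbd : ∀ y, x ⊆ y → bd f y = 0) :
    ∃ g : Finset V → ℝ, (∀ y, g y ≠ 0 → ∃ v ∈ y, f (y.erase v) ≠ 0) ∧
      (∀ y, ¬ (x ⊆ y ∧ y ⊆ z) → g y = 0) ∧ ∀ y, x ⊆ y → bd g y = f y := by
  obtain ⟨v, hvz, hvx⟩ := exists_of_ssubset hxz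
  -- The cone over `f` with apex `v`, which may be added to any set of the interval.
  refine ⟨fun y => if v ∈ y then sg v y * f (y.erase v) else 0, ?_, ?_, ?_⟩
  · intro y hy
    by_cases hv : v ∈ y
    · exact ⟨v, hv, fun h => hy (by simp [h])⟩
    · simp [hv] at hy
  · intro y hy
    by_cases hv : v ∈ y
    · simp only [hv, if_true]
      rw [hf, mul_zero]
      rintro ⟨h1, h2⟩
      refine hy ⟨h1.trans (erase_subset v y), ?_⟩
      rw [← insert_erase hv]
      exact insert_subset hvz h2
    · simp [hv]
  · intro y hxy
    rw [bd_apply]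
    by_cases hv : v ∈ y
    · have hx : x ⊆ y.erase v := subset_erase.mpr ⟨hxy, hvx⟩
      -- The cycle condition at `y.erase v` expresses `f y` by exactly the values that occur in the
      -- boundary of the cone at `y`.
      have h := hbd _ hx
      have hc : (y.erase v)ᶜ = insert v yᶜ := by simp
      rw [bd_apply, hc, sum_insert (by simp [hv]), insert_erase hv, sg_erase_self] at h
      have key : ∑ w ∈ yᶜ, sg w y * (sg v (insert w y) * f ((insert w y).erase v)) =
          -(sg v y * ∑ w ∈ yᶜ, sg w (y.erase v) * f (insert w (y.erase v))) := by
        rw [mul_sum, ← sum_neg_distrib]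
        refine sum_congr rfl fun w hw => ?_
        have hw' := mem_compl.mp hw
        have hvw : v ≠ w := fun e => hw' (e ▸ hv)
        rw [erase_insert_of_ne (Ne.symm hvw)]
        have hs := sg_comm hvw (notMem_erase v y) (fun h => hw' (mem_of_mem_erase h))
        rw [insert_erase hv, sg_erase_self] at hs
        have hs2 : sg v (insert w y) = sg v (insert w (y.erase v)) := by
          rw [← sg_erase_self v (insert w y), erase_insert_of_ne (Ne.symm hvw)]
        rw [hs2]
        have h1 := sg_mul_self w (y.erase v)
        have h2 := sg_mul_self w y
        have h3 : sg w y * sg v (insert w (y.erase v)) = -(sg v y * sg w (y.erase v)) := by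
          linear_combination (sg w y * sg w (y.erase v)) * hs -
            (sg w y * sg v (insert w (y.erase v))) * h1 - (sg w (y.erase v) * sg v y) * h2
        linear_combination f (insert w (y.erase v)) * h3
      have e : ∀ w ∈ yᶜ, (sg w y * if v ∈ insert w y then
          sg v (insert w y) * f ((insert w y).erase v) else 0) =
          sg w y * (sg v (insert w y) * f ((insert w y).erase v)) := fun w _ => by
        rw [if_pos (mem_insert_of_mem hv)]
      rw [sum_congr rfl e, key]
      have h1 := sg_mul_self v y
      linear_combination (- sg v y) * h + f y * h1
    · rw [sum_eq_single_of_mem v (mem_compl.mpr hv)]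
      · rw [if_pos (mem_insert_self v y), erase_insert hv, sg_insert_self hv, ← mul_assoc,
          sg_mul_self, one_mul]
      · intro w _ hwv
        rw [if_neg (by simp [hv, Ne.symm hwv]), mul_zero]

/-- A linear form that vanishes on the kernel of `T` factors through `T`. -/
theorem exists_dual_factor {ι κ : Type*} [Fintype ι] [Fintype κ] [DecidableEq κ]
    (T : (ι → ℝ) →ₗ[ℝ] (κ → ℝ))
    (a : ι → ℝ) (h : ∀ f, T f = 0 → ∑ i, a i * f i = 0) :
    ∃ b : κ → ℝ, ∀ f, ∑ i, a i * f i = ∑ j, b j * T f j := by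
  let α : Module.Dual ℝ (ι → ℝ) := ∑ i, a i • LinearMap.proj i
  have hα : ∀ f, α f = ∑ i, a i * f i := fun f => by simp [α]
  have : α ∈ LinearMap.range T.dualMap := by
    rw [LinearMap.range_dualMap_eq_dualAnnihilator_ker, Submodule.mem_dualAnnihilator]
    intro f hf
    rw [hα]
    exact h f hf
  obtain ⟨β, hβ⟩ := this
  refine ⟨fun j => β (Pi.single j 1), fun f => ?_⟩
  rw [← hα, ← hβ, LinearMap.dualMap_apply]
  conv_lhs => rw [pi_eq_sum_univ' (T f)]
  rw [map_sum]
  exact sum_congr rfl fun j _ => by rw [map_smul, smul_eq_mul, mul_comm]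

end SetChain

/-! ### Chains, cycles and strong connectivity -/

namespace SetChain

open Finset

variable {V : Type*} [Fintype V] [LinearOrder V]

/-- The functions supported on the elements of `S` of cardinality `m`. -/
def chains (S : Set (Finset V)) (m : ℤ) : Submodule ℝ (Finset V → ℝ) where
  carrier := {f | ∀ y, ¬ (y ∈ S ∧ (y.card : ℤ) = m) → f y = 0}
  add_mem' hf hg y hy := by rw [Pi.add_apply, hf y hy, hg y hy, add_zero]
  zero_mem' _ _ := rfl
  smul_mem' c f hf y hy := by rw [Pi.smul_apply, hf y hy, smul_zero]

/-- The relative cycles: chains on `S` whose boundary vanishes on `S`. -/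
def cycles (S : Set (Finset V)) (m : ℤ) : Submodule ℝ (Finset V → ℝ) where
  carrier := {f | f ∈ chains S m ∧ ∀ y ∈ S, bd f y = 0}
  add_mem' hf hg := ⟨add_mem hf.1 hg.1, fun y hy => by
    rw [map_add, Pi.add_apply, hf.2 y hy, hg.2 y hy, add_zero]⟩
  zero_mem' := ⟨zero_mem _, fun y _ => by rw [map_zero, Pi.zero_apply]⟩
  smul_mem' c f hf := ⟨Submodule.smul_mem _ c hf.1, fun y hy => by
    rw [map_smul, Pi.smul_apply, hf.2 y hy, smul_zero]⟩

/-- Every relative cycle of cardinality `m` on `S` is a relative boundary. -/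
def ExactAt (S : Set (Finset V)) (m : ℤ) : Prop :=
  ∀ f ∈ cycles S m, ∃ g ∈ chains S (m + 1), ∀ y ∈ S, bd g y = f y

/-- `z` is a basis of the submodule `N`. -/
def IsGenerator {M : Type*} [AddCommGroup M] [Module ℝ M] (N : Submodule ℝ M) (z : M) : Prop :=
  z ∈ N ∧ z ≠ 0 ∧ ∀ f ∈ N, ∃ c : ℝ, f = c • z

/-- The homology of all `K ∩ [x, 1̂)` is concentrated in the top degree. -/
def HasTopHomology (K : Set (Finset V)) (n : ℕ) : Prop :=
  ∀ x ∈ K, ∀ m : ℤ, m < n → ExactAt (K ∩ Set.Ici x) m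

omit [Fintype V] [LinearOrder V] in
theorem mem_chains_of_ne {S : Set (Finset V)} {m : ℤ} {f : Finset V → ℝ} (hf : f ∈ chains S m)
    {y : Finset V} (hy : f y ≠ 0) : y ∈ S ∧ (y.card : ℤ) = m := by
  by_contra h
  exact hy (hf y h)

omit [Fintype V] in
theorem cut_mem_chains {K : Set (Finset V)} {m : ℤ} {f : Finset V → ℝ} (hf : f ∈ chains K m)
    (x : Finset V) : cut x f ∈ chains (K ∩ Set.Ici x) m := by
  intro y hy
  by_cases hxy : x ⊆ y
  · rw [cut_of_subset hxy]
    exact hf y fun h => hy ⟨⟨h.1, hxy⟩, h.2⟩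
  · exact cut_of_not_subset hxy f

theorem exactAt_of_forall_card_ne {S : Set (Finset V)} {m : ℤ}
    (h : ∀ y ∈ S, (y.card : ℤ) ≠ m) : ExactAt S m := by
  intro f hf
  refine ⟨0, zero_mem _, fun y _ => ?_⟩
  rw [map_zero, Pi.zero_apply, hf.1 y fun hy => h y hy.1 hy.2]

theorem exactAt_of_cycles_eq_zero {S : Set (Finset V)} {m : ℤ}
    (h : ∀ f ∈ cycles S m, f = 0) : ExactAt S m := by
  intro f hf
  exact ⟨0, zero_mem _, fun y _ => by rw [h f hf, map_zero]⟩

omit [Fintype V] in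
theorem single_mem_chains {S : Set (Finset V)} {x : Finset V} (hx : x ∈ S) :
    (Pi.single x 1 : Finset V → ℝ) ∈ chains S x.card := by
  intro y hy
  rw [Pi.single_apply, if_neg]
  rintro rfl
  exact hy ⟨hx, rfl⟩

theorem single_mem_cycles {K : Set (Finset V)} {x : Finset V} (hx : x ∈ K) :
    (Pi.single x 1 : Finset V → ℝ) ∈ cycles (K ∩ Set.Ici x) x.card := by
  refine ⟨single_mem_chains ⟨hx, le_refl x⟩, fun y hy => bd_eq_zero fun v hv => ?_⟩
  rw [Pi.single_apply, if_neg]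
  intro h
  exact hv (hy.2 (h ▸ mem_insert_self v y))

/-! ### Purity and strong connectivity of Cohen–Macaulay complexes. -/

section Facet

variable {K : Set (Finset V)} {n : ℕ}

/-- The basis vector at `x` is a relative cycle above `x`. Below the top degree it must bound, which
needs a coface. -/
theorem HasTopHomology.exists_insert_mem (hCM : HasTopHomology K n) {x : Finset V} (hx : x ∈ K)
    (hxn : x.card < n) : ∃ v ∉ x, insert v x ∈ K := by
  obtain ⟨g, hg, hgx⟩ := hCM x hx x.card (by exact_mod_cast hxn) _ (single_mem_cycles hx)
  by_contra! h
  have h1 := hgx x ⟨hx, le_refl x⟩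
  rw [bd_eq_zero, Pi.single_eq_same] at h1
  · exact zero_ne_one h1
  · intro v hv
    exact hg _ fun h' => h v hv h'.1.1

theorem HasTopHomology.exists_facet (hCM : HasTopHomology K n) (hn : ∀ y ∈ K, y.card ≤ n)
    {x : Finset V} (hx : x ∈ K) : ∃ z ∈ K, x ⊆ z ∧ z.card = n := by
  induction h : n - x.card generalizing x with
  | zero => exact ⟨x, hx, subset_rfl, le_antisymm (hn x hx) (by omega)⟩
  | succ k ih =>
    obtain ⟨v, hv, hvK⟩ := hCM.exists_insert_mem hx (by omega)
    obtain ⟨z, hz, hxz, hzn⟩ := ih hvK (by rw [card_insert_of_notMem hv]; omega)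
    exact ⟨z, hz, (subset_insert v x).trans hxz, hzn⟩

/-- The chain `± e_{x ∪ v} ∓ e_{x ∪ w}`, with boundary zero at `x`. -/
def edge (x : Finset V) (v w : V) : Finset V → ℝ :=
  sg v x • Pi.single (insert v x) 1 - sg w x • Pi.single (insert w x) 1

omit [Fintype V] in
theorem insert_inj_of_notMem {x : Finset V} {v w : V} (hv : v ∉ x) (h : insert v x = insert w x) :
    v = w := by
  have := h ▸ mem_insert_self v x
  exact (mem_insert.mp this).resolve_right hv

theorem edge_mem_cycles {x : Finset V} {v w : V} (hv : v ∉ x) (hw : w ∉ x)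
    (hvK : insert v x ∈ K) (hwK : insert w x ∈ K) :
    edge x v w ∈ cycles (K ∩ Set.Ici x) (x.card + 1) := by
  refine ⟨?_, fun y hy => ?_⟩
  · have h1 := single_mem_chains (S := K ∩ Set.Ici x) ⟨hvK, subset_insert v x⟩
    have h2 := single_mem_chains (S := K ∩ Set.Ici x) ⟨hwK, subset_insert w x⟩
    rw [card_insert_of_notMem hv, Nat.cast_add, Nat.cast_one] at h1
    rw [card_insert_of_notMem hw, Nat.cast_add, Nat.cast_one] at h2
    exact sub_mem (Submodule.smul_mem _ _ h1) (Submodule.smul_mem _ _ h2)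
  -- Above `x`, each of the two terms has the indicator of `x` as its boundary, so the difference is
  -- a cycle.
  · have key : ∀ u ∉ x, bd (sg u x • Pi.single (insert u x) (1 : ℝ)) y = if y = x then 1 else 0 := by
      intro u hu
      rw [map_smul, Pi.smul_apply, smul_eq_mul]
      split_ifs with h
      · subst h
        rw [bd_apply, sum_eq_single_of_mem u (mem_compl.mpr hu), Pi.single_eq_same, mul_one,
          sg_mul_self]
        intro t ht htu
        rw [Pi.single_apply, if_neg, mul_zero]
        exact fun e => htu (insert_inj_of_notMem (mem_compl.mp ht) e)
      · rw [bd_eq_zero, mul_zero]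
        intro t ht
        rw [Pi.single_apply, if_neg]
        intro e
        have h1 := congrArg card e
        rw [card_insert_of_notMem ht, card_insert_of_notMem hu] at h1
        exact h (eq_of_subset_of_card_le hy.2 (by omega)).symm
    rw [edge, map_sub, Pi.sub_apply, key v hv, key w hw, sub_self]

omit [Fintype V] in
theorem edge_apply_insert {x : Finset V} {v w u : V} (hu : u ∉ x) :
    edge x v w (insert u x) = (if u = v then sg v x else 0) - if u = w then sg w x else 0 := by
  have key : ∀ t, (Pi.single (insert t x) 1 : Finset V → ℝ) (insert u x) = if u = t then 1 else 0 := by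
    intro t
    rw [Pi.single_apply]
    by_cases h : u = t
    · simp [h]
    · rw [if_neg h, if_neg fun e => h (insert_inj_of_notMem hu e)]
  simp only [edge, Pi.sub_apply, Pi.smul_apply, key, smul_eq_mul, mul_ite, mul_one, mul_zero]

/-- Strong connectivity: a set of facets which, with a facet, contains its neighbours, contains
all facets or none. -/
theorem HasTopHomology.strongly_connected (hCM : HasTopHomology K n) (hK : IsLowerSet K)
    (hn : ∀ y ∈ K, y.card ≤ n) {x : Finset V} (hx : x ∈ K) (A : Finset V → Prop)
    (hA : ∀ r ∈ K, x ⊆ r → r.card + 1 = n → ∀ v ∉ r, ∀ w ∉ r, insert v r ∈ K → insert w r ∈ K →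
      A (insert v r) → A (insert w r))
    {z z' : Finset V} (hz : z ∈ K) (hxz : x ⊆ z) (hzn : z.card = n) (hz' : z' ∈ K)
    (hxz' : x ⊆ z') (hzn' : z'.card = n) (hAz : A z) : A z' := by
  classical
  induction h : n - x.card using Nat.strong_induction_on generalizing x z z' with
  | _ k ih =>
  have hxn := hn x hx
  by_contra hAz'
  have hzz : z ≠ z' := fun e => hAz' (e ▸ hAz)
  have hlt : x.card < n := by
    refine lt_of_le_of_ne hxn fun e => hzz ?_
    rw [← eq_of_subset_of_card_le hxz (by omega), ← eq_of_subset_of_card_le hxz' (by omega)]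
  have hssub : ∀ t : Finset V, x ⊆ t → t.card = n → ∃ v ∈ t, v ∉ x := fun t ht htn =>
    exists_of_ssubset (ssubset_of_subset_of_ne ht fun e => by rw [e] at hlt; omega)
  obtain ⟨v, hvz, hvx⟩ := hssub z hxz hzn
  obtain ⟨w, hwz, hwx⟩ := hssub z' hxz' hzn'
  have hvz' : insert v x ⊆ z := insert_subset hvz hxz
  have hwz' : insert w x ⊆ z' := insert_subset hwz hxz'
  have hvK := hK hvz' hz
  have hwK := hK hwz' hz'
  -- all facets above `insert u x` are of the same type
  have step : ∀ u ∉ x, insert u x ∈ K → ∀ t ∈ K, ∀ t' ∈ K, insert u x ⊆ t → insert u x ⊆ t' →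
      t.card = n → t'.card = n → A t → A t' := by
    intro u hu huK t ht t' ht' hut hut' htn htn' hAt
    refine ih (n - (insert u x).card) ?_ huK ?_ ht hut htn ht' hut' htn' hAt rfl
    · rw [card_insert_of_notMem hu]; omega
    · exact fun r hr hur => hA r hr ((subset_insert u x).trans hur)
  by_cases hlt2 : x.card + 1 = n
  · have e1 := eq_of_subset_of_card_le hvz' (by rw [card_insert_of_notMem hvx]; omega)
    have e2 := eq_of_subset_of_card_le hwz' (by rw [card_insert_of_notMem hwx]; omega)
    exact hAz' (e2 ▸ hA x hx subset_rfl hlt2 v hvx w hwx hvK hwK (e1 ▸ hAz))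
  -- Exactness in this degree is the vanishing of the reduced H_0 of the link: a 1-chain `g` of the
  -- link joins `v` to `w`.
  · obtain ⟨g, hg, hgf⟩ := hCM x hx (x.card + 1) (by omega) _ (edge_mem_cycles hvx hwx hvK hwK)
    -- An edge of `g` lies in a facet, so by `step` it does not leave `B`. Hence the boundary of `g`
    -- has total weight 0 on `B`, whereas `v ∈ B` and `w ∉ B` make this weight 1.
    let B : V → Prop := fun u => ∃ t ∈ K, insert u x ⊆ t ∧ t.card = n ∧ A t
    have hB := sum_bd_insert g x B (by
      intro u u' hu hu' huu hBu hBu'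
      by_contra hne
      have hmem := (mem_chains_of_ne hg hne).1.1
      obtain ⟨t, ht, hut, htn⟩ := hCM.exists_facet hn hmem
      have h1 : insert u x ⊆ t := (subset_insert u' _).trans hut
      have h2 : insert u' x ⊆ t := (insert_subset_insert u' (subset_insert u x)).trans hut
      obtain ⟨t0, ht0, hut0, htn0, hAt0⟩ := hBu
      exact hBu' ⟨t, ht, h2, htn, step u hu (hK h1 ht) t0 ht0 t ht hut0 h1 htn0 htn hAt0⟩)
    have hBv : B v := ⟨z, hz, hvz', hzn, hAz⟩
    have hBw : ¬ B w := by
      rintro ⟨t, ht, hwt, htn, hAt⟩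
      exact hAz' (step w hwx hwK t ht z' hz' hwt hwz' htn hzn' hAt)
    have hval : ∀ u ∈ xᶜ.filter B, sg u x * bd g (insert u x) = if u = v then 1 else 0 := by
      intro u hu
      rw [mem_filter, mem_compl] at hu
      obtain ⟨t, ht, hut, -⟩ := hu.2
      have huw : u ≠ w := fun e => hBw (e ▸ hu.2)
      rw [hgf _ ⟨hK hut ht, subset_insert u x⟩, edge_apply_insert hu.1, if_neg huw, sub_zero]
      split_ifs with e
      · rw [e, sg_mul_self]
      · rw [mul_zero]
    rw [sum_congr rfl hval, sum_ite_eq', if_pos (by simp [hvx, hBv])] at hB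
    exact one_ne_zero hB

end Facet

end SetChain

/-! ### Fundamental classes and duality -/

namespace SetChain

open Finset

variable {V : Type*} [Fintype V] [LinearOrder V]

/-- A chain `ζ` of facets whose restriction to `[x, 1̂)` is a basis of the top homology if `x ∈ S`,
while this homology vanishes if `x ∉ S`. -/
structure IsFundamentalClass (K : Set (Finset V)) (n : ℕ) (S : Set (Finset V))
    (ζ : Finset V → ℝ) : Prop where
  mem : ζ ∈ chains K n
  isGenerator : ∀ x ∈ K, x ∈ S → IsGenerator (cycles (K ∩ Set.Ici x) n) (cut x ζ)
  eq_zero : ∀ x ∈ K, x ∉ S → ∀ f ∈ cycles (K ∩ Set.Ici x) n, f = 0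

/-- Boundary and coboundary in different variables commute. -/
theorem cobd_bd_comm (a : Finset V → Finset V → ℝ) (y z : Finset V) :
    cobd (fun z' => bd (fun y' => a y' z') y) z = bd (fun y' => cobd (a y') z) y := by
  simp only [cobd_apply, bd_apply, mul_sum]
  rw [sum_comm]
  exact sum_congr rfl fun v _ => sum_congr rfl fun w _ => by ring

theorem cycles_eq_zero_of_notMem {K : Set (Finset V)} (hK : IsLowerSet K) {y : Finset V}
    (hy : y ∉ K) {m : ℤ} {f : Finset V → ℝ} (hf : f ∈ cycles (K ∩ Set.Ici y) m) : f = 0 := by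
  funext z
  exact hf.1 z fun h => hy (hK h.1.2 h.1.1)

/-- A functional on the chains above `y` that vanishes on cycles is a coboundary. -/
theorem exists_cobd_eq {K : Set (Finset V)} {y : Finset V} {q : ℕ}
    {α : Finset V → ℝ} (hα : α ∈ chains (K ∩ Set.Ici y) q)
    (h : ∀ f ∈ cycles (K ∩ Set.Ici y) q, ∑ z, α z * f z = 0) :
    ∃ β : Finset V → ℝ, (∀ z, β z ≠ 0 → z ∈ K ∧ y ⊆ z ∧ z.card + 1 = q) ∧
      ∀ z ∈ K, α z = cobd β z := by
  classical
  let ind (P : Finset V → Prop) : (Finset V → ℝ) →ₗ[ℝ] (Finset V → ℝ) :=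
    LinearMap.pi fun z => if P z then LinearMap.proj z else 0
  have ind_apply : ∀ P f z, ind P f z = if P z then f z else 0 := by
    intro P f z
    simp only [ind, LinearMap.pi_apply]
    split_ifs <;> rfl
  let P1 : Finset V → Prop := fun z => z ∈ K ∩ Set.Ici y
  let P2 : Finset V → Prop := fun z => z ∈ K ∩ Set.Ici y ∧ (z.card : ℤ) = q
  -- The boundary is truncated on both sides so that the kernel consists, up to irrelevant
  -- coordinates, of the relative cycles.
  obtain ⟨β, hβ⟩ := exists_dual_factor (ind P1 ∘ₗ bd ∘ₗ ind P2) α (by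
    intro f hf
    have hc : ind P2 f ∈ cycles (K ∩ Set.Ici y) q := by
      refine ⟨fun z hz => ?_, fun z hz => ?_⟩
      · rw [ind_apply, if_neg hz]
      · have := congrFun hf z
        rwa [LinearMap.comp_apply, ind_apply, if_pos hz] at this
    rw [← h _ hc]
    refine sum_congr rfl fun z _ => ?_
    rw [ind_apply]
    split_ifs with hz
    · rfl
    · rw [hα z hz, zero_mul, zero_mul])
  refine ⟨fun z => if z ∈ K ∩ Set.Ici y ∧ z.card + 1 = q then β z else 0, ?_, ?_⟩
  · intro z hz
    by_contra hz'
    exact hz (if_neg fun hc => hz' ⟨hc.1.1, hc.1.2, hc.2⟩)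
  · intro z hz
    by_cases hz2 : P2 z
    -- Testing on a basis vector isolates `α z`, and transposing `bd` yields the coboundary.
    · have h1 := hβ (Pi.single z 1)
      have h2 : ind P2 (Pi.single z 1) = Pi.single z 1 := by
        funext w
        rw [ind_apply, Pi.single_apply]
        by_cases hw : w = z
        · rw [hw, if_pos hz2]
        · rw [if_neg hw, ite_self]
      have h3 : ∀ w, β w * (ind P1 ∘ₗ bd ∘ₗ ind P2) (Pi.single z 1) w =
          ind P1 β w * bd (Pi.single z 1) w := by
        intro w
        rw [LinearMap.comp_apply, LinearMap.comp_apply, h2, ind_apply, ind_apply]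
        split_ifs <;> simp
      rw [sum_congr rfl fun w _ => h3 w, sum_mul_bd] at h1
      simp only [Pi.single_apply, mul_ite, mul_one, mul_zero, sum_ite_eq', mem_univ, if_true] at h1
      rw [h1, cobd_apply, cobd_apply]
      refine sum_congr rfl fun v hv => ?_
      have hc : (z.erase v).card + 1 = q := by
        rw [card_erase_add_one hv]; exact_mod_cast hz2.2
      rw [ind_apply]
      simp only [P1, hc, and_true]
      split_ifs <;> rfl
    · rw [hα z hz2, cobd_eq_zero]
      intro v hv
      refine if_neg fun hc => hz2 ⟨⟨hz, hc.1.2.trans (erase_subset v z)⟩, ?_⟩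
      rw [card_erase_add_one hv] at hc
      exact_mod_cast hc.2

/-- The bidegree and support condition for functions of pairs `x ⊆ y ⊆ z ∈ K`. -/
def HasBidegree (K : Set (Finset V)) (x : Finset V) (p q : ℕ) (a : Finset V → Finset V → ℝ) :
    Prop :=
  ∀ y z, a y z ≠ 0 → x ⊆ y ∧ y ⊆ z ∧ z ∈ K ∧ y.card = p ∧ z.card = q

theorem exists_ne_of_bd_ne {f : Finset V → ℝ} {y : Finset V} (h : bd f y ≠ 0) :
    ∃ v ∉ y, f (insert v y) ≠ 0 := by
  by_contra! h'
  exact h (bd_eq_zero h')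

omit [Fintype V] in
theorem exists_ne_of_cobd_ne {f : Finset V → ℝ} {y : Finset V} (h : cobd f y ≠ 0) :
    ∃ v ∈ y, f (y.erase v) ≠ 0 := by
  by_contra! h'
  exact h (cobd_eq_zero h')

/-! ### The double complex of pairs x ⊆ y ⊆ z, and duality. -/

section Double

variable {K : Set (Finset V)} {x : Finset V}

/-- Row exactness: for fixed z the variable y runs over the interval [x, z], and p < q rules out the
only non-acyclic case x = z. -/
theorem HasBidegree.exists_bd_eq {p q : ℕ} (hpq : p < q) {a : Finset V → Finset V → ℝ}
    (ha : HasBidegree K x p q a) (hbd : ∀ y z, x ⊆ y → bd (fun y' => a y' z) y = 0) :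
    ∃ b, HasBidegree K x (p + 1) q b ∧ ∀ y z, x ⊆ y → a y z = bd (fun y' => b y' z) y := by
  have key : ∀ z, ∃ g : Finset V → ℝ, (∀ y, g y ≠ 0 →
      x ⊆ y ∧ y ⊆ z ∧ z ∈ K ∧ y.card = p + 1 ∧ z.card = q) ∧ ∀ y, x ⊆ y → a y z = bd g y := by
    intro z
    by_cases h0 : ∃ y, a y z ≠ 0
    · obtain ⟨y, hy⟩ := h0
      obtain ⟨h1, h2, h3, h4, h5⟩ := ha y z hy
      have hxz : x ⊂ z := by
        refine lt_of_le_of_lt h1 (lt_of_le_of_ne h2 ?_)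
        rintro rfl
        omega
      obtain ⟨g, hg1, hg2, hg3⟩ := exists_bd_eq_of_interval hxz (f := fun y => a y z) (by
        intro y hy
        by_contra hne
        obtain ⟨h1, h2, -⟩ := ha y z hne
        exact hy ⟨h1, h2⟩) (fun y hy => hbd y z hy)
      refine ⟨g, fun y hy => ?_, fun y hy => (hg3 y hy).symm⟩
      have h6 : x ⊆ y ∧ y ⊆ z := by
        by_contra hne
        exact hy (hg2 y hne)
      obtain ⟨v, hv, hne⟩ := hg1 y hy
      obtain ⟨-, -, -, h7, -⟩ := ha _ _ hne
      rw [← card_erase_add_one hv, h7]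
      exact ⟨h6.1, h6.2, h3, rfl, h5⟩
    · push Not at h0
      refine ⟨0, fun y hy => absurd rfl hy, fun y _ => ?_⟩
      rw [h0, map_zero, Pi.zero_apply]
  choose g hg1 hg2 using key
  exact ⟨fun y z => g z y, fun y z h => hg1 z y h, fun y z hy => hg2 z y hy⟩

/-- A staircase argument down the diagonal of fixed difference `s`. Write ∂ for the boundary in y
and δ for the coboundary in z. Orthogonality to cycles gives ∂a = δa' one step lower; by induction
a' = ∂b' + δe'; then a - δb' is a row cycle, hence some ∂b. -/
theorem HasBidegree.exists_decomposition {n : ℕ} (hK : IsLowerSet K) (hCM : HasTopHomology K n)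
    {s : ℕ} (hs : 0 < s) (p : ℕ) (hp : p + s ≤ n) {a : Finset V → Finset V → ℝ}
    (ha : HasBidegree K x p (p + s) a)
    (hcyc : ∀ y, x ⊆ y → ∀ f ∈ cycles (K ∩ Set.Ici y) (p + s : ℕ),
      ∑ z, bd (fun y' => a y' z) y * f z = 0) :
    ∃ b e : Finset V → Finset V → ℝ, HasBidegree K x (p + 1) (p + s) b ∧
      (∀ y z, e y z ≠ 0 → y ⊆ z ∧ z ∈ K) ∧
      ∀ y z, x ⊆ y → z ∈ K → a y z = bd (fun y' => b y' z) y + cobd (e y) z := by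
  induction p generalizing a with
  | zero =>
    -- At `p = 0` the staircase ends: ∂a would live on sets of negative cardinality.
    obtain ⟨b, hb, hab⟩ := ha.exists_bd_eq (by omega) (by
      intro y z _
      refine bd_eq_zero fun v hv => ?_
      by_contra hne
      have := (ha _ _ hne).2.2.2.1
      rw [card_insert_of_notMem hv] at this
      omega)
    refine ⟨b, 0, hb, fun y z h => absurd rfl h, fun y z hy _ => ?_⟩
    rw [hab y z hy, Pi.zero_apply, map_zero, Pi.zero_apply, add_zero]
  | succ p ih =>
    have hsupp : ∀ y z, bd (fun y' => a y' z) y ≠ 0 →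
        y ⊆ z ∧ z ∈ K ∧ y.card = p ∧ z.card = p + 1 + s := by
      intro y z h
      obtain ⟨v, hv, hne⟩ := exists_ne_of_bd_ne h
      obtain ⟨-, h2, h3, h4, h5⟩ := ha _ _ hne
      rw [card_insert_of_notMem hv] at h4
      exact ⟨(subset_insert v y).trans h2, h3, by omega, h5⟩
    have hcol : ∀ y, ∃ β : Finset V → ℝ,
        (∀ z, β z ≠ 0 → x ⊆ y ∧ y ⊆ z ∧ z ∈ K ∧ y.card = p ∧ z.card = p + s) ∧
        (x ⊆ y → ∀ z ∈ K, bd (fun y' => a y' z) y = cobd β z) := by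
      intro y
      by_cases hy : x ⊆ y ∧ y.card = p
      · obtain ⟨β, hβ1, hβ2⟩ := exists_cobd_eq (K := K) (y := y) (q := p + 1 + s)
          (α := fun z => bd (fun y' => a y' z) y) (by
            intro z hz
            by_contra hne
            obtain ⟨h1, h2, -, h4⟩ := hsupp y z hne
            exact hz ⟨⟨h2, h1⟩, by exact_mod_cast h4⟩) (hcyc y hy.1)
        refine ⟨β, fun z hz => ?_, fun _ => hβ2⟩
        obtain ⟨h1, h2, h3⟩ := hβ1 z hz
        exact ⟨hy.1, h2, h1, hy.2, by omega⟩
      · refine ⟨0, fun z hz => absurd rfl hz, fun hxy z _ => ?_⟩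
        rw [map_zero, Pi.zero_apply]
        by_contra hne
        exact hy ⟨hxy, (hsupp y z hne).2.2.1⟩
    choose a' ha' haa' using hcol
    -- Orthogonality passes to `a'`: a cycle of cardinality p + s < n is some ∂g, and ⟨∂a', ∂g⟩ =
    -- ⟨∂δa', g⟩ = ⟨∂∂a, g⟩ = 0.
    obtain ⟨b', e', hb', -, hbe'⟩ := ih (by omega) (a := a') ha' (by
      intro y hxy f hf
      by_cases hyK : y ∈ K
      · obtain ⟨g, hg, hgf⟩ := hCM y hyK (p + s : ℕ) (by exact_mod_cast (by omega)) f hf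
        have h1 : ∑ z, bd (fun y' => a' y' z) y * f z =
            ∑ z, bd (fun y' => a' y' z) y * bd g z := by
          refine sum_congr rfl fun z _ => ?_
          by_cases hz : bd (fun y' => a' y' z) y = 0
          · rw [hz, zero_mul, zero_mul]
          · obtain ⟨v, hv, hne⟩ := exists_ne_of_bd_ne hz
            obtain ⟨-, h2, h3, -⟩ := ha' _ _ hne
            rw [hgf z ⟨h3, (subset_insert v y).trans h2⟩]
        rw [h1, sum_mul_bd]
        refine sum_eq_zero fun w _ => ?_
        by_cases hw : g w = 0
        · rw [hw, mul_zero]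
        · have hwK := (mem_chains_of_ne hg hw).1.1
          have h2 : bd (fun y' => cobd (a' y') w) y = bd (bd (fun y' => a y' w)) y := by
            rw [bd_apply, bd_apply (bd _)]
            exact sum_congr rfl fun v _ => by
              rw [haa' _ (hxy.trans (subset_insert v y)) w hwK]
          rw [cobd_bd_comm, h2, bd_bd, Pi.zero_apply, zero_mul]
      · rw [cycles_eq_zero_of_notMem hK hyK hf]; simp)
    classical
    -- The coboundary may leave `K`, hence the cutoff. On `K`, ∂(a - δb') = δa' - δ∂b' = δδe' = 0.
    let a2 : Finset V → Finset V → ℝ := fun y z => a y z - if z ∈ K then cobd (b' y) z else 0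
    have ha2 : HasBidegree K x (p + 1) (p + 1 + s) a2 := by
      intro y z hne
      by_cases h : a y z = 0
      · by_cases hz : z ∈ K
        · simp only [a2, h, hz, if_true, zero_sub, ne_eq, neg_eq_zero] at hne
          obtain ⟨v, hv, hne⟩ := exists_ne_of_cobd_ne hne
          obtain ⟨h1, h2, -, h4, h5⟩ := hb' _ _ hne
          have := card_erase_add_one hv
          exact ⟨h1, h2.trans (erase_subset v z), hz, h4, by omega⟩
        · simp [a2, h, hz] at hne
      · exact ha y z h
    obtain ⟨b, hb, hab⟩ := ha2.exists_bd_eq (by omega) (by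
      intro y z hxy
      by_cases hz : z ∈ K
      · have e1 : (fun y' => a2 y' z) = (fun y' => a y' z) - fun y' => cobd (b' y') z := by
          funext y'; simp [a2, hz]
        have e2 : cobd (a' y) z = cobd ((fun z' => bd (fun y' => b' y' z') y) + cobd (e' y)) z := by
          rw [cobd_apply, cobd_apply]
          refine sum_congr rfl fun v _ => ?_
          rw [hbe' y _ hxy (hK (erase_subset v z) hz), Pi.add_apply]
        rw [e1, map_sub, Pi.sub_apply, haa' y hxy z hz, e2, map_add, cobd_cobd, Pi.add_apply,
          cobd_bd_comm, Pi.zero_apply, add_zero, sub_self]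
      · refine bd_eq_zero fun v _ => ?_
        by_contra hne
        exact hz (ha2 _ _ hne).2.2.1)
    refine ⟨b, b', hb, fun y z h => ⟨(hb' y z h).2.1, (hb' y z h).2.2.1⟩, fun y z hy hz => ?_⟩
    rw [← hab y z hy]
    simp [a2, hz]

/-- Duality: the part of `K` in `S` has homology in the top degree only. -/
theorem IsFundamentalClass.exactAt {n : ℕ} {S : Set (Finset V)} {ζ : Finset V → ℝ}
    (hζ : IsFundamentalClass K n S ζ) (hK : IsLowerSet K) (hCM : HasTopHomology K n)
    (hS : ∀ y ∈ S, ∀ y' ∈ K, y ⊆ y' → y' ∈ S) (x : Finset V) {m : ℤ} (hm : m < n) :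
    ExactAt (K ∩ S ∩ Set.Ici x) m := by
  classical
  rcases lt_or_ge m 0 with h0 | h0
  · exact exactAt_of_forall_card_ne fun y _ => by omega
  lift m to ℕ using h0
  obtain ⟨s, rfl⟩ := Nat.exists_eq_add_of_lt (Int.ofNat_lt.mp hm)
  intro c hc
  -- Pairing with ζ in the variable z maps top columns to chains on S. To lift `c`, put the weight
  -- `c y / ζ z` on one facet z above y with `ζ z ≠ 0`.
  have hlift : ∀ y, ∃ α : Finset V → ℝ, (∀ z, α z ≠ 0 →
      x ⊆ y ∧ y ⊆ z ∧ z ∈ K ∧ y.card = m ∧ z.card = m + (s + 1)) ∧ ∑ z, α z * ζ z = c y := by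
    intro y
    by_cases hy : c y = 0
    · exact ⟨0, fun z hz => absurd rfl hz, by simp [hy]⟩
    · obtain ⟨⟨⟨hyK, hyS⟩, hxy⟩, hym⟩ := mem_chains_of_ne hc.1 hy
      obtain ⟨z, hz⟩ := Function.ne_iff.mp (hζ.isGenerator y hyK hyS).2.1
      have hyz : y ⊆ z := by
        by_contra hyz
        exact hz (cut_of_not_subset hyz ζ)
      rw [cut_of_subset hyz, Pi.zero_apply] at hz
      obtain ⟨hzK, hzn⟩ := mem_chains_of_ne hζ.mem hz
      refine ⟨Pi.single z (c y / ζ z), fun w hw => ?_, ?_⟩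
      · have hwz : w = z := by
          by_contra hwz
          exact hw (by rw [Pi.single_apply, if_neg hwz])
        rw [hwz]
        exact ⟨hxy, hyz, hzK, by exact_mod_cast hym, by exact_mod_cast hzn⟩
      · simp [Pi.single_apply, hz]
  choose a ha hac using hlift
  have hbd : ∀ (u : Finset V → Finset V → ℝ) (y : Finset V),
      ∑ z, bd (fun y' => u y' z) y * ζ z = bd (fun y' => ∑ z, u y' z * ζ z) y := by
    intro u y
    simp only [bd_apply, sum_mul, mul_sum]
    rw [sum_comm]
    exact sum_congr rfl fun v _ => sum_congr rfl fun w _ => by ring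
  -- For y ∈ S the cycles above y are multiples of ζ, and pairing ∂a with ζ gives the boundary of
  -- `c` at y, which is 0. For y ∉ S there are no nonzero cycles.
  obtain ⟨b, e, hb, he, habe⟩ := HasBidegree.exists_decomposition hK hCM (x := x) (Nat.succ_pos s) m
    (by omega) (a := a) ha (by
      intro y hxy f hf
      by_cases hyK : y ∈ K
      · by_cases hyS : y ∈ S
        · obtain ⟨k, rfl⟩ := (hζ.isGenerator y hyK hyS).2.2 f hf
          have h1 : ∀ z, bd (fun y' => a y' z) y * (k • cut y ζ) z =
              k * (bd (fun y' => a y' z) y * ζ z) := by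
            intro z
            by_cases hz : bd (fun y' => a y' z) y = 0
            · rw [hz]; ring
            · obtain ⟨v, hv, hne⟩ := exists_ne_of_bd_ne hz
              rw [Pi.smul_apply, cut_of_subset ((subset_insert v y).trans (ha _ _ hne).2.1),
                smul_eq_mul]
              ring
          rw [sum_congr rfl fun z _ => h1 z, ← mul_sum, hbd, funext hac, hc.2 y ⟨⟨hyK, hyS⟩, hxy⟩,
            mul_zero]
        · rw [hζ.eq_zero y hyK hyS f hf]; simp
      · rw [cycles_eq_zero_of_notMem hK hyK hf]; simp)
  have hbK : ∀ y z, b y z ≠ 0 → y ∈ K := fun y z h => hK (hb y z h).2.1 (hb y z h).2.2.1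
  -- Pairing `b` with ζ gives the bounding chain. Truncation to `S` does not affect boundaries at
  -- points of `S`, because `S` is upward closed in `K`.
  refine ⟨fun y => if y ∈ S then ∑ z, b y z * ζ z else 0, ?_, ?_⟩
  · intro y hy
    by_cases hyS : y ∈ S
    · simp only [hyS, if_true]
      refine sum_eq_zero fun z _ => ?_
      by_contra hne
      have hbne := left_ne_zero_of_mul hne
      obtain ⟨h1, -, -, h4, -⟩ := hb y z hbne
      exact hy ⟨⟨⟨hbK y z hbne, hyS⟩, h1⟩, by exact_mod_cast h4⟩
    · exact if_neg hyS
  · rintro y ⟨⟨hyK, hyS⟩, hxy⟩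
    have h1 : bd (fun y => if y ∈ S then ∑ z, b y z * ζ z else 0) y =
        bd (fun y' => ∑ z, b y' z * ζ z) y := by
      rw [bd_apply, bd_apply]
      refine sum_congr rfl fun v _ => congrArg _ ?_
      split_ifs with h
      · rfl
      · refine (sum_eq_zero fun z _ => ?_).symm
        by_contra hne
        exact h (hS y hyS _ (hbK _ z (left_ne_zero_of_mul hne)) (subset_insert v y))
    have h2 : ∀ z, bd (fun y' => b y' z) y * ζ z = a y z * ζ z - cobd (e y) z * ζ z := by
      intro z
      by_cases hz : ζ z = 0
      · rw [hz]; ring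
      · rw [habe y z hxy (mem_chains_of_ne hζ.mem hz).1]; ring
    -- The term δe disappears: by transposition it pairs `e` with ∂ζ, which vanishes on `K` above y
    -- ∈ S.
    rw [h1, ← hbd, sum_congr rfl fun z _ => h2 z, sum_sub_distrib, hac, ← sum_mul_bd,
      sub_eq_self]
    refine sum_eq_zero fun z _ => ?_
    by_cases hz : e y z = 0
    · rw [hz, zero_mul]
    · obtain ⟨hyz, hzK⟩ := he y z hz
      rw [← bd_cut hyz, (hζ.isGenerator y hyK hyS).1.2 z ⟨hzK, hyz⟩, mul_zero]

end Double

end SetChain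

/-! ### Existence of fundamental classes and the homology of the boundary -/

namespace SetChain

open Finset

variable {V : Type*} [Fintype V] [LinearOrder V] {K : Set (Finset V)} {n : ℕ}

/-- The cycle `edge r v w` is nonzero at `insert w r` and is a multiple of the generator. -/
theorem IsGenerator.apply_insert_ne_zero {r : Finset V} {v w : V} (hrn : r.card + 1 = n)
    {u : Finset V → ℝ} (hu : IsGenerator (cycles (K ∩ Set.Ici r) n) u) (hv : v ∉ r) (hw : w ∉ r)
    (hvK : insert v r ∈ K) (hwK : insert w r ∈ K) (hvw : v ≠ w) : u (insert w r) ≠ 0 := by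
  have he := edge_mem_cycles hv hw hvK hwK
  rw [show (r.card : ℤ) + 1 = n by exact_mod_cast hrn] at he
  obtain ⟨c, hc⟩ := hu.2.2 _ he
  intro h0
  have := congrFun hc (insert w r)
  rw [edge_apply_insert hw, if_neg hvw.symm, if_pos rfl, Pi.smul_apply, h0, smul_zero, zero_sub,
    neg_eq_zero] at this
  exact sg_ne_zero w r this

/-- Two distinct facets through the ridge `r` would give the nonzero cycle `edge r v w`. -/
theorem eq_of_cycles_eq_zero {r : Finset V} {v w : V} (hrn : r.card + 1 = n)
    (hr : ∀ f ∈ cycles (K ∩ Set.Ici r) n, f = 0) (hv : v ∉ r) (hw : w ∉ r)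
    (hvK : insert v r ∈ K) (hwK : insert w r ∈ K) : v = w := by
  have he := edge_mem_cycles hv hw hvK hwK
  rw [show (r.card : ℤ) + 1 = n by exact_mod_cast hrn] at he
  by_contra hvw
  have := congrFun (hr _ he) (insert w r)
  rw [edge_apply_insert hw, if_neg (Ne.symm hvw), if_pos rfl, zero_sub, Pi.zero_apply,
    neg_eq_zero] at this
  exact sg_ne_zero w r this

theorem IsGenerator.of_mem {M : Type*} [AddCommGroup M] [Module ℝ M] {N : Submodule ℝ M} {u z : M}
    (hu : IsGenerator N u) (hz : z ∈ N) (hz0 : z ≠ 0) : IsGenerator N z := by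
  refine ⟨hz, hz0, fun f hf => ?_⟩
  obtain ⟨c, rfl⟩ := hu.2.2 z hz
  obtain ⟨d, rfl⟩ := hu.2.2 f hf
  have hc : c ≠ 0 := fun h => hz0 (by rw [h, zero_smul])
  exact ⟨d / c, by rw [smul_smul, div_mul_cancel₀ _ hc]⟩

theorem cut_mem_cycles {S : Set (Finset V)} {x : Finset V} {f : Finset V → ℝ}
    (hS : ∀ y ∈ S, ∀ y' ∈ K, y ⊆ y' → y' ∈ S) (hxS : x ∈ S) (hf : f ∈ chains K n)
    (hbd : ∀ y ∈ K, y ∈ S → x ⊆ y → bd f y = 0) : cut x f ∈ cycles (K ∩ Set.Ici x) n := by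
  refine ⟨cut_mem_chains hf x, fun y hy => ?_⟩
  rw [bd_cut hy.2]
  exact hbd y hy.1 (hS x hxS y hy.1 hy.2) hy.2

/-- A relative cycle of facets is a fundamental class if it is not zero. -/
theorem isFundamentalClass_of_generators {S : Set (Finset V)} (hK : IsLowerSet K)
    (hn : ∀ y ∈ K, y.card ≤ n) (hCM : HasTopHomology K n) (h0 : ∅ ∈ K)
    (hS : ∀ y ∈ S, ∀ y' ∈ K, y ⊆ y' → y' ∈ S)
    (hgen : ∀ x ∈ K, x ∈ S → ∃ u, IsGenerator (cycles (K ∩ Set.Ici x) n) u)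
    (hzero : ∀ x ∈ K, x ∉ S → ∀ f ∈ cycles (K ∩ Set.Ici x) n, f = 0)
    {ζ : Finset V → ℝ} (hζ : ζ ∈ chains K n) (hζ0 : ζ ≠ 0) (hbd : ∀ y ∈ K, y ∈ S → bd ζ y = 0) :
    IsFundamentalClass K n S ζ := by
  have hcyc : ∀ x, x ∈ S → cut x ζ ∈ cycles (K ∩ Set.Ici x) n := fun x hxS =>
    cut_mem_cycles hS hxS hζ fun y hy hyS _ => hbd y hy hyS
  have hne : ∀ z ∈ K, z.card = n → ζ z ≠ 0 := by
    intro z hz hzn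
    obtain ⟨z0, hz0⟩ := Function.ne_iff.mp hζ0
    obtain ⟨hz0K, hz0n⟩ := mem_chains_of_ne hζ hz0
    refine hCM.strongly_connected hK hn h0 (fun z => ζ z ≠ 0) ?_ hz0K (empty_subset _)
      (by exact_mod_cast hz0n) hz (empty_subset _) hzn hz0
    intro r hr _ hrn v hv w hw hvK hwK hζv
    by_cases hvw : v = w
    · exact hvw ▸ hζv
    -- Over a ridge in `S` the restriction of ζ is a generator, so it is nonzero on the neighbouring
    -- facet as well; a ridge outside `S` lies in only one facet.
    by_cases hrS : r ∈ S
    · obtain ⟨u, hu⟩ := hgen r hr hrS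
      have hg : IsGenerator (cycles (K ∩ Set.Ici r) n) (cut r ζ) := by
        refine hu.of_mem (hcyc r hrS) fun h => hζv ?_
        rw [← cut_of_subset (subset_insert v r) ζ, h, Pi.zero_apply]
      have := hg.apply_insert_ne_zero hrn hv hw hvK hwK hvw
      rwa [cut_of_subset (subset_insert w r)] at this
    · exact absurd (eq_of_cycles_eq_zero hrn (hzero r hr hrS) hv hw hvK hwK) hvw
  refine ⟨hζ, fun x hx hxS => ?_, hzero⟩
  obtain ⟨u, hu⟩ := hgen x hx hxS
  obtain ⟨z, hz, hxz, hzn⟩ := hCM.exists_facet hn hx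
  refine hu.of_mem (hcyc x hxS) fun h => hne z hz hzn ?_
  rw [← cut_of_subset hxz ζ, h, Pi.zero_apply]

namespace IsFundamentalClass

variable {S : Set (Finset V)} {ζ : Finset V → ℝ}

theorem facet_mem (hζ : IsFundamentalClass K n S ζ) {z : Finset V} (hz : z ∈ K)
    (hzn : z.card = n) : z ∈ S := by
  by_contra hzS
  have h := hζ.eq_zero z hz hzS (Pi.single z 1) (by
    rw [← hzn]; exact single_mem_cycles hz)
  simpa using congrFun h z

theorem apply_ne_zero (hζ : IsFundamentalClass K n S ζ) {z : Finset V} (hz : z ∈ K)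
    (hzn : z.card = n) : ζ z ≠ 0 := by
  obtain ⟨w, hw⟩ := Function.ne_iff.mp (hζ.isGenerator z hz (hζ.facet_mem hz hzn)).2.1
  have hzw : z ⊆ w := by
    by_contra h
    exact hw (cut_of_not_subset h ζ)
  rw [cut_of_subset hzw, Pi.zero_apply] at hw
  have hwn : (w.card : ℤ) = n := (mem_chains_of_ne hζ.mem hw).2
  rwa [eq_of_subset_of_card_le hzw (by rw [hzn]; exact_mod_cast hwn.le)]

theorem bd_eq_zero (hζ : IsFundamentalClass K n S ζ) {y : Finset V} (hy : y ∈ K) (hyS : y ∈ S) :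
    bd ζ y = 0 := by
  rw [← bd_cut (subset_refl y)]
  exact (hζ.isGenerator y hy hyS).1.2 y ⟨hy, le_refl y⟩

/-- The fundamental class spans the relative cycles of facets. -/
theorem exists_eq_smul (hζ : IsFundamentalClass K n S ζ) (hK : IsLowerSet K)
    (hn : ∀ y ∈ K, y.card ≤ n) (hCM : HasTopHomology K n)
    (hS : ∀ y ∈ S, ∀ y' ∈ K, y ⊆ y' → y' ∈ S) {x : Finset V} (hx : x ∈ K)
    {f : Finset V → ℝ} (hf : f ∈ cycles (K ∩ S ∩ Set.Ici x) n) :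
    ∃ c : ℝ, f = c • cut x ζ := by
  obtain ⟨z0, hz0, hxz0, hz0n⟩ := hCM.exists_facet hn hx
  have hfK : f ∈ chains K n := fun y hy => hf.1 y fun h => hy ⟨h.1.1.1, h.2⟩
  refine ⟨f z0 / ζ z0, funext fun z => ?_⟩
  rw [Pi.smul_apply, smul_eq_mul]
  by_cases hz : (z ∈ K ∧ z.card = n) ∧ x ⊆ z
  · rw [cut_of_subset hz.2]
    -- The ratio f / ζ is preserved across ridges, since over a ridge in `S` both restrictions lie
    -- in a one-dimensional space.
    refine hCM.strongly_connected hK hn hx (fun z => f z = f z0 / ζ z0 * ζ z) ?_ hz0 hxz0 hz0n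
      hz.1.1 hz.2 hz.1.2 (div_mul_cancel₀ _ (hζ.apply_ne_zero hz0 hz0n)).symm
    intro r hr hxr hrn v hv w hw hvK hwK hfv
    by_cases hrS : r ∈ S
    · obtain ⟨k, hk⟩ := (hζ.isGenerator r hr hrS).2.2 (cut r f)
        (cut_mem_cycles hS hrS hfK fun y hy hyS hry => hf.2 y ⟨⟨hy, hyS⟩, hxr.trans hry⟩)
      have hk' : ∀ t, f (insert t r) = k * ζ (insert t r) := fun t => by
        have := congrFun hk (insert t r)
        rwa [Pi.smul_apply, cut_of_subset (subset_insert t r), cut_of_subset (subset_insert t r),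
          smul_eq_mul] at this
      have hζv := hζ.apply_ne_zero hvK (by rw [card_insert_of_notMem hv, hrn])
      rw [hk' v] at hfv
      rw [hk' w, mul_right_cancel₀ hζv hfv]
    · exact eq_of_cycles_eq_zero hrn (hζ.eq_zero r hr hrS) hv hw hvK hwK ▸ hfv
  · rw [hf.1 z fun h => hz ⟨⟨h.1.1.1, by exact_mod_cast h.2⟩, h.1.2⟩]
    by_cases hxz : x ⊆ z
    · rw [cut_of_subset hxz, hζ.mem z fun h => hz ⟨⟨h.1, by exact_mod_cast h.2⟩, hxz⟩, mul_zero]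
    · rw [cut_of_not_subset hxz, mul_zero]

end IsFundamentalClass

/-! ### The boundary subcomplex and its connecting homomorphism. -/

section Boundary

variable {D : Set (Finset V)} {d : ℕ} {ζ : Finset V → ℝ}

omit [Fintype V] [LinearOrder V] in
theorem compl_upward (hD : IsLowerSet D) : ∀ y ∈ Dᶜ, ∀ y' ∈ K, y ⊆ y' → y' ∈ Dᶜ :=
  fun _ hy _ _ hyy hy' => hy (hD hyy hy')

/-- As `D` is closed under passing to faces, a chain on `D` has no boundary outside `D`. -/
theorem cycles_subcomplex_le (hD : IsLowerSet D) (hDK : D ⊆ K) (x : Finset V) (m : ℤ) :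
    cycles (D ∩ Set.Ici x) m ≤ cycles (K ∩ Set.Ici x) m := by
  intro f hf
  refine ⟨fun y hy => hf.1 y fun h => hy ⟨⟨hDK h.1.1, h.1.2⟩, h.2⟩, fun y hy => ?_⟩
  by_cases hyD : y ∈ D
  · exact hf.2 y ⟨hyD, hy.2⟩
  · exact bd_eq_zero fun v _ => hf.1 _ fun h => hyD (hD (subset_insert v y) h.1.1)

theorem bd_mem_chains (hK : IsLowerSet K) {m : ℤ} {f : Finset V → ℝ}
    (hf : f ∈ chains K (m + 1)) : bd f ∈ chains K m := by
  intro y hy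
  by_contra hne
  obtain ⟨v, hv, hne⟩ := exists_ne_of_bd_ne hne
  obtain ⟨h1, h2⟩ := mem_chains_of_ne hf hne
  rw [card_insert_of_notMem hv] at h2
  push_cast at h2
  exact hy ⟨hK (subset_insert v y) h1, by omega⟩

/-- A cycle f on D bounds some g in K. The part of g off D is a relative cycle, hence by duality the
boundary of some h off D; then g - ∂h lies on D and still bounds f. -/
theorem IsFundamentalClass.boundary_exactAt (hK : IsLowerSet K) (hD : IsLowerSet D) (hDK : D ⊆ K)
    (hCM : HasTopHomology K n) (hζ : IsFundamentalClass K n Dᶜ ζ) {x : Finset V} (hx : x ∈ D)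
    {m : ℤ} (hm : m + 1 < n) : ExactAt (D ∩ Set.Ici x) m := by
  classical
  intro f hf
  obtain ⟨g, hg, hgf⟩ := hCM x (hDK hx) m (by omega) f (cycles_subcomplex_le hD hDK x m hf)
  -- The hypothesis `hm` is sharp here: duality is applied in degree m + 1, which must lie below n.
  obtain ⟨h, hh, hhg⟩ := hζ.exactAt hK hCM (compl_upward hD) x hm
    (fun y => if y ∈ D then 0 else g y) (by
      refine ⟨fun y hy => ?_, fun y hy => ?_⟩
      · beta_reduce
        split_ifs with hyD
        · rfl
        · exact hg y fun h => hy ⟨⟨⟨h.1.1, hyD⟩, h.1.2⟩, h.2⟩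
      · have h1 : bd (fun y => if y ∈ D then 0 else g y) y = bd g y := by
          rw [bd_apply, bd_apply]
          exact sum_congr rfl fun v _ => by
            rw [if_neg fun hv => hy.1.2 (hD (subset_insert v y) hv)]
        rw [h1, hgf y ⟨hy.1.1, hy.2⟩]
        exact hf.1 y fun h => hy.1.2 h.1.1)
  refine ⟨g - cut x (bd h), fun y hy => ?_, fun y hy => ?_⟩
  · rw [Pi.sub_apply]
    by_cases hyK : (y ∈ K ∧ x ⊆ y) ∧ (y.card : ℤ) = m + 1
    · have hyD : y ∉ D := fun h => hy ⟨⟨h, hyK.1.2⟩, hyK.2⟩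
      rw [cut_of_subset hyK.1.2, hhg y ⟨⟨hyK.1.1, hyD⟩, hyK.1.2⟩, if_neg hyD, sub_self]
    · have hhK : h ∈ chains K (m + 1 + 1) := fun y hy => hh y fun h => hy ⟨h.1.1.1, h.2⟩
      have h2 := cut_mem_chains (bd_mem_chains hK hhK) x
      rw [hg y hyK, h2 y hyK, sub_zero]
  · rw [map_sub, Pi.sub_apply, bd_cut hy.2, bd_bd, Pi.zero_apply, sub_zero,
      hgf y ⟨hDK hy.1, hy.2⟩]

/-- The connecting map sends ζ to ∂ζ. If ∂ζ vanished above x, then ζ would restrict to a nonzero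
element of Z_x = 0. It spans because every cycle on D is the boundary of a relative cycle of facets,
a multiple of ζ. -/
theorem IsFundamentalClass.boundary_isGenerator (hK : IsLowerSet K) (hn : ∀ y ∈ K, y.card ≤ n)
    (hD : IsLowerSet D) (hDK : D ⊆ K) (hd : ∀ y ∈ D, y.card ≤ d) (hdn : d + 1 = n)
    (hCM : HasTopHomology K n) (hζ : IsFundamentalClass K n Dᶜ ζ) {x : Finset V} (hx : x ∈ D) :
    IsGenerator (cycles (D ∩ Set.Ici x) d) (cut x (bd ζ)) := by
  have hdn' : (n : ℤ) = (d : ℤ) + 1 := by exact_mod_cast hdn.symm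
  have hbζ : bd ζ ∈ chains D d := by
    have h1 : bd ζ ∈ chains K d := bd_mem_chains hK (hdn' ▸ hζ.mem)
    intro y hy
    by_cases hyK : y ∈ K ∧ (y.card : ℤ) = d
    · exact hζ.bd_eq_zero hyK.1 fun hyD => hy ⟨hyD, hyK.2⟩
    · exact h1 y hyK
  have hmem : cut x (bd ζ) ∈ cycles (D ∩ Set.Ici x) d := by
    refine ⟨cut_mem_chains hbζ x, fun y hy => ?_⟩
    rw [bd_cut hy.2, bd_bd, Pi.zero_apply]
  refine ⟨hmem, fun h0 => ?_, fun f hf => ?_⟩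
  · obtain ⟨z, hz, hxz, hzn⟩ := hCM.exists_facet hn (hDK hx)
    have h1 := hζ.eq_zero x (hDK hx) (fun h => h hx) (cut x ζ) ⟨cut_mem_chains hζ.mem x, by
      intro y hy
      rw [bd_cut hy.2, ← cut_of_subset hy.2 (bd ζ), h0, Pi.zero_apply]⟩
    refine hζ.apply_ne_zero hz hzn ?_
    rw [← cut_of_subset hxz ζ, h1, Pi.zero_apply]
  · obtain ⟨g, hg, hgf⟩ := hCM x (hDK hx) d (by omega) f (cycles_subcomplex_le hD hDK x d hf)
    rw [← hdn'] at hg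
    obtain ⟨c, rfl⟩ := hζ.exists_eq_smul hK hn hCM (compl_upward hD) (hDK hx) (f := g) (by
      refine ⟨fun y hy => hg y fun h => hy ⟨⟨⟨h.1.1, fun hyD => ?_⟩, h.1.2⟩, h.2⟩, fun y hy => ?_⟩
      · have h1 := hd y hyD
        have h2 : y.card = n := by exact_mod_cast h.2
        omega
      · rw [hgf y ⟨hy.1.1, hy.2⟩]
        exact hf.1 y fun h => hy.1.2 h.1.1)
    refine ⟨c, funext fun y => ?_⟩
    by_cases hy : y ∈ D ∧ x ⊆ y
    · rw [← hgf y ⟨hDK hy.1, hy.2⟩, map_smul, Pi.smul_apply, Pi.smul_apply, bd_cut hy.2,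
        cut_of_subset hy.2]
    · rw [hf.1 y fun h => hy h.1, Pi.smul_apply, hmem.1 y fun h => hy h.1, smul_zero]

/-- A fundamental class from a generator of the top homology of the boundary. -/
theorem exists_relative_cycle (hD : IsLowerSet D) (hDK : D ⊆ K) (h0 : ∅ ∈ D) (hdn : d + 1 = n)
    (hCM : HasTopHomology K n) {u : Finset V → ℝ} (hu : u ∈ cycles (D ∩ Set.Ici ∅) d)
    (hu0 : u ≠ 0) :
    ∃ ζ ∈ chains K n, ζ ≠ 0 ∧ ∀ y ∈ K, y ∈ Dᶜ → bd ζ y = 0 := by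
  have hdn' : (n : ℤ) = (d : ℤ) + 1 := by exact_mod_cast hdn.symm
  obtain ⟨ζ, hζ, hζu⟩ := hCM ∅ (hDK h0) d (by omega) u (cycles_subcomplex_le hD hDK ∅ d hu)
  rw [← hdn'] at hζ
  refine ⟨ζ, fun y hy => hζ y fun h => hy ⟨h.1.1, h.2⟩, ?_, fun y hy hyD => ?_⟩
  · rintro rfl
    refine hu0 (funext fun y => ?_)
    by_cases hy : y ∈ D
    · rw [← hζu y ⟨hDK hy, empty_subset y⟩, map_zero]
    · exact hu.1 y fun h => hy h.1.1
  · rw [hζu y ⟨hy, empty_subset y⟩]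
    exact hu.1 y fun h => hyD h.1.1

end Boundary

end SetChain

/-! ### Comparison with simplicial homology and cellular cohomology -/

namespace SetChain

open Finset

theorem subsingleton_homology_iff {C₂ C₁ C₀ : Type*} [AddCommGroup C₂] [Module ℝ C₂]
    [AddCommGroup C₁] [Module ℝ C₁] [AddCommGroup C₀] [Module ℝ C₀]
    (d₂ : C₂ →ₗ[ℝ] C₁) (d₁ : C₁ →ₗ[ℝ] C₀) :
    Subsingleton (d₁.ker ⧸ d₂.range.submoduleOf d₁.ker) ↔ ∀ a, d₁ a = 0 → ∃ b, d₂ b = a := by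
  rw [Submodule.Quotient.subsingleton_iff, Submodule.submoduleOf_eq_top]
  exact Iff.rfl

theorem nonempty_equiv_real_iff {M : Type*} [AddCommGroup M] [Module ℝ M] (N : Submodule ℝ M) :
    Nonempty (N ≃ₗ[ℝ] ℝ) ↔ ∃ u, IsGenerator N u := by
  constructor
  · rintro ⟨e⟩
    refine ⟨e.symm 1, (e.symm 1).2, fun h => ?_, fun f hf => ⟨e ⟨f, hf⟩, ?_⟩⟩
    · rw [Submodule.coe_eq_zero, map_eq_zero_iff _ e.symm.injective] at h
      exact one_ne_zero h
    · rw [← Submodule.coe_smul, ← map_smul, smul_eq_mul, mul_one, e.symm_apply_apply]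
  · rintro ⟨u, hu, hu0, h⟩
    refine ⟨(LinearEquiv.ofBijective (LinearMap.toSpanSingleton ℝ N ⟨u, hu⟩) ⟨?_, ?_⟩).symm⟩
    · rw [← LinearMap.ker_eq_bot]
      exact LinearMap.ker_toSpanSingleton ℝ fun e => hu0 (congrArg Subtype.val e)
    · rintro ⟨f, hf⟩
      obtain ⟨c, rfl⟩ := h f hf
      exact ⟨c, rfl⟩

variable {V : Type*} [Fintype V] [LinearOrder V]

/-! ### Homology of a complex identified with chains of finite sets. -/

section Transfer

variable {C₂ C₁ C₀ : Type*} [AddCommGroup C₂] [Module ℝ C₂]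
  [AddCommGroup C₁] [Module ℝ C₁] [AddCommGroup C₀] [Module ℝ C₀]
  {d₂ : C₂ →ₗ[ℝ] C₁} {d₁ : C₁ →ₗ[ℝ] C₀} {S : Set (Finset V)} {m₂ m m₀ : ℤ}

theorem mem_ker_iff_mem_cycles (e₁ : C₁ ≃ₗ[ℝ] chains S m) (e₀ : C₀ ≃ₗ[ℝ] chains S m₀)
    (h₁ : ∀ a, ∀ y ∈ S, (e₀ (d₁ a) : Finset V → ℝ) y = bd (e₁ a) y) (a : C₁) :
    d₁ a = 0 ↔ (e₁ a : Finset V → ℝ) ∈ cycles S m := by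
  constructor
  · intro ha
    refine ⟨(e₁ a).2, fun y hy => ?_⟩
    rw [← h₁ a y hy, ha, map_zero]; rfl
  · intro ha
    rw [← map_eq_zero_iff _ e₀.injective]
    refine Subtype.ext (funext fun y => ?_)
    by_cases hy : y ∈ S
    · rw [h₁ a y hy, ha.2 y hy]; rfl
    · exact (e₀ (d₁ a)).2 y fun h => hy h.1

theorem subsingleton_homology_iff_exactAt (e₂ : C₂ ≃ₗ[ℝ] chains S m₂) (e₁ : C₁ ≃ₗ[ℝ] chains S m)
    (e₀ : C₀ ≃ₗ[ℝ] chains S m₀) (hm : m₂ = m + 1)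
    (h₂ : ∀ a, ∀ y ∈ S, (e₁ (d₂ a) : Finset V → ℝ) y = bd (e₂ a) y)
    (h₁ : ∀ a, ∀ y ∈ S, (e₀ (d₁ a) : Finset V → ℝ) y = bd (e₁ a) y) :
    Subsingleton (d₁.ker ⧸ d₂.range.submoduleOf d₁.ker) ↔ ExactAt S m := by
  subst hm
  rw [subsingleton_homology_iff]
  constructor
  · intro h f hf
    obtain ⟨b, hb⟩ := h (e₁.symm ⟨f, hf.1⟩) (by
      rw [mem_ker_iff_mem_cycles e₁ e₀ h₁, e₁.apply_symm_apply]; exact hf)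
    refine ⟨e₂ b, (e₂ b).2, fun y hy => ?_⟩
    rw [← h₂ b y hy, hb, e₁.apply_symm_apply]
  · intro h a ha
    obtain ⟨g, hg, hgf⟩ := h _ ((mem_ker_iff_mem_cycles e₁ e₀ h₁ a).mp ha)
    refine ⟨e₂.symm ⟨g, hg⟩, e₁.injective (Subtype.ext (funext fun y => ?_))⟩
    by_cases hy : y ∈ S
    · rw [h₂ _ y hy, e₂.apply_symm_apply, hgf y hy]
    · rw [(e₁ a).2 y fun h => hy h.1]
      exact (e₁ _).2 y fun h => hy h.1

omit [Fintype V] [LinearOrder V] in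
theorem eq_zero_of_mem_chains {n : ℕ} (hn : ∀ y ∈ S, y.card ≤ n) (hm : (n : ℤ) < m)
    {f : Finset V → ℝ} (hf : f ∈ chains S m) : f = 0 := by
  funext y
  refine hf y fun h => ?_
  have := hn y h.1
  omega

omit [Fintype V] [LinearOrder V] in
theorem range_submoduleOf_eq_bot {n : ℕ} (hn : ∀ y ∈ S, y.card ≤ n) (hm : (n : ℤ) < m₂)
    (e₂ : C₂ ≃ₗ[ℝ] chains S m₂) : d₂.range.submoduleOf d₁.ker = ⊥ := by
  rw [eq_bot_iff]
  rintro a ⟨b, hb⟩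
  have hb0 : b = 0 := by
    refine e₂.injective (Subtype.ext ?_)
    rw [eq_zero_of_mem_chains hn hm (e₂ b).2, map_zero, Submodule.coe_zero]
  rw [hb0, map_zero] at hb
  exact Subtype.ext hb.symm

/-- The kernel of the differential in terms of cycles. -/
noncomputable def kerEquiv (e₁ : C₁ ≃ₗ[ℝ] chains S m) (e₀ : C₀ ≃ₗ[ℝ] chains S m₀)
    (h₁ : ∀ a, ∀ y ∈ S, (e₀ (d₁ a) : Finset V → ℝ) y = bd (e₁ a) y) :
    d₁.ker ≃ₗ[ℝ] cycles S m :=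
  LinearEquiv.ofBijective
    (((chains S m).subtype ∘ₗ e₁.toLinearMap ∘ₗ d₁.ker.subtype).codRestrict (cycles S m)
      fun a => (mem_ker_iff_mem_cycles e₁ e₀ h₁ a).mp a.2) <| by
    constructor
    · intro a b hab
      have h : (e₁ a.1 : Finset V → ℝ) = e₁ b.1 :=
        congrArg (fun f : cycles S m => (f : Finset V → ℝ)) hab
      exact Subtype.ext (e₁.injective (Subtype.ext h))
    · rintro ⟨f, hf⟩
      refine ⟨⟨e₁.symm ⟨f, hf.1⟩, ?_⟩, Subtype.ext ?_⟩
      · rw [LinearMap.mem_ker, mem_ker_iff_mem_cycles e₁ e₀ h₁, e₁.apply_symm_apply]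
        exact hf
      · change ((e₁ (e₁.symm ⟨f, hf.1⟩) : chains S m) : Finset V → ℝ) = f
        rw [e₁.apply_symm_apply]

/-- In the top degree, the homology consists of the cycles. -/
noncomputable def topEquiv {n : ℕ} (hn : ∀ y ∈ S, y.card ≤ n) (hm : (n : ℤ) < m₂)
    (e₂ : C₂ ≃ₗ[ℝ] chains S m₂) (e₁ : C₁ ≃ₗ[ℝ] chains S m) (e₀ : C₀ ≃ₗ[ℝ] chains S m₀)
    (h₁ : ∀ a, ∀ y ∈ S, (e₀ (d₁ a) : Finset V → ℝ) y = bd (e₁ a) y) :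
    (d₁.ker ⧸ d₂.range.submoduleOf d₁.ker) ≃ₗ[ℝ] cycles S m :=
  (Submodule.quotEquivOfEqBot _ (range_submoduleOf_eq_bot hn hm e₂)).trans (kerEquiv e₁ e₀ h₁)

end Transfer

/-- The sum over the sets of an index type that contain `y` as a facet. -/
theorem sum_cofaces {ι : Type*} [Fintype ι] (s : ι → Finset V) (hs : Function.Injective s)
    (y : Finset V) (G : Finset V → ℝ) (hG : ∀ t, G t ≠ 0 → ∃ i, s i = t) (F : ι → ℝ)
    (hF : ∀ i, y ⊆ s i ∧ (s i).card = y.card + 1 → F i = simplexSign (s i) y * G (s i))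
    (hF0 : ∀ i, ¬ (y ⊆ s i ∧ (s i).card = y.card + 1) → F i = 0) :
    ∑ i, F i = bd G y := by
  classical
  let H : Finset V → ℝ := fun t =>
    if y ⊆ t ∧ t.card = y.card + 1 then simplexSign t y * G t else 0
  have h1 : ∑ i, F i = ∑ t ∈ univ.image s, H t := by
    rw [sum_image fun i _ j _ h => hs h]
    refine sum_congr rfl fun i _ => ?_
    by_cases h : y ⊆ s i ∧ (s i).card = y.card + 1
    · rw [hF i h]; exact (if_pos h).symm
    · rw [hF0 i h]; exact (if_neg h).symm
  have h2 : ∑ t ∈ univ.image s, H t = ∑ t, H t := by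
    refine sum_subset (subset_univ _) fun t _ ht => ?_
    have hGt : G t = 0 := by
      by_contra hne
      obtain ⟨i, rfl⟩ := hG t hne
      exact ht (mem_image_of_mem s (mem_univ i))
    simp only [H, hGt, mul_zero, ite_self]
  have h3 : ∑ t, H t = ∑ t ∈ yᶜ.image (fun v => insert v y), H t := by
    refine (sum_subset (subset_univ _) fun t _ ht => if_neg ?_).symm
    rintro ⟨hyt, hc⟩
    obtain ⟨v, hv⟩ := card_eq_one.mp (show (t \ y).card = 1 by
      rw [card_sdiff_of_subset hyt]; omega)
    have hvt : v ∈ t \ y := hv ▸ mem_singleton_self v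
    refine ht (mem_image.mpr ⟨v, mem_compl.mpr (mem_sdiff.mp hvt).2, ?_⟩)
    rw [insert_eq, ← hv, sdiff_union_of_subset hyt]
  rw [h1, h2, h3, sum_image fun v hv w _ h =>
    insert_inj_of_notMem (mem_compl.mp (mem_coe.mp hv)) h, bd_apply]
  refine sum_congr rfl fun v hv => ?_
  have hv' := mem_compl.mp hv
  rw [← simplexSign_insert hv']
  exact if_pos ⟨subset_insert v y, card_insert_of_notMem hv'⟩

end SetChain

/-! ### Simplicial chains of links as chains above a simplex. -/

namespace PreAbstractSimplicialComplex

open Finset SetChain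

variable {V : Type*}

/-- The set of simplices, including the empty one. -/
def simplexSet (Δ : PreAbstractSimplicialComplex V) : Set (Finset V) := {s | s = ∅ ∨ s ∈ Δ.faces}

theorem empty_mem_simplexSet (Δ : PreAbstractSimplicialComplex V) : ∅ ∈ Δ.simplexSet := Or.inl rfl

theorem isLowerSet_simplexSet (Δ : PreAbstractSimplicialComplex V) :
    IsLowerSet Δ.simplexSet := by
  intro s t hts hs
  rcases t.eq_empty_or_nonempty with h | h
  · exact Or.inl h
  · rcases hs with rfl | hs
    · exact Or.inl (subset_empty.mp hts)
    · exact Or.inr ((Δ.isRelLowerSet_faces hs).2 hts h)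

theorem mem_simplexSet_link [DecidableEq V] (Δ : PreAbstractSimplicialComplex V) {x : Finset V}
    (hx : x ∈ Δ.simplexSet) {t : Finset V} :
    t ∈ (Δ.link x).simplexSet ↔ Disjoint t x ∧ t ∪ x ∈ Δ.simplexSet := by
  rcases t.eq_empty_or_nonempty with h | h
  · subst h
    exact ⟨fun _ => ⟨disjoint_empty_left x, by rwa [empty_union]⟩, fun _ => Or.inl rfl⟩
  · constructor
    · rintro (h0 | ⟨-, h1, h2⟩)
      · exact absurd h0 h.ne_empty
      · exact ⟨h1, Or.inr h2⟩
    · rintro ⟨h1, h2 | h2⟩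
      · exact absurd (union_eq_empty.mp h2).1 h.ne_empty
      · exact Or.inr ⟨h, h1, h2⟩

variable [Fintype V]

theorem card_le_rank (Δ : PreAbstractSimplicialComplex V) {y : Finset V} (hy : y ∈ Δ.simplexSet) :
    y.card ≤ Δ.rank :=
  le_sup (f := fun x : Δ.Simplex => x.1.card) (mem_univ (⟨y, hy⟩ : Δ.Simplex))

variable [LinearOrder V]

open Classical in
/-- Simplicial chains as functions of all finite sets. -/
noncomputable def chainEquiv (Δ : PreAbstractSimplicialComplex V) (i : ℤ) :
    Δ.Chain i ≃ₗ[ℝ] chains Δ.simplexSet (i + 1) where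
  toFun a := ⟨fun y => if h : y ∈ Δ.simplexSet ∧ (y.card : ℤ) = i + 1 then a ⟨⟨y, h.1⟩, h.2⟩ else 0,
    fun _ hy => dif_neg hy⟩
  map_add' a b := by
    refine Subtype.ext (funext fun y => ?_)
    by_cases h : y ∈ Δ.simplexSet ∧ (y.card : ℤ) = i + 1 <;> simp [h]
  map_smul' c a := by
    refine Subtype.ext (funext fun y => ?_)
    by_cases h : y ∈ Δ.simplexSet ∧ (y.card : ℤ) = i + 1 <;> simp [h]
  invFun f y := f.1 y.1.1
  left_inv a := by
    funext y
    exact dif_pos (show y.1.1 ∈ Δ.simplexSet ∧ _ from ⟨y.1.2, y.2⟩)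
  right_inv f := by
    refine Subtype.ext (funext fun y => ?_)
    by_cases h : y ∈ Δ.simplexSet ∧ (y.card : ℤ) = i + 1
    · simp [h]
    · simp only [h, dif_neg, not_false_eq_true]
      exact (f.2 y h).symm

omit [Fintype V] [LinearOrder V] in
theorem chainEquiv_apply (Δ : PreAbstractSimplicialComplex V) (i : ℤ) (a : Δ.Chain i)
    (y : Δ.SimplexOfDim i) : (Δ.chainEquiv i a).1 y.1.1 = a y :=
  dif_pos (show y.1.1 ∈ Δ.simplexSet ∧ _ from ⟨y.1.2, y.2⟩)

theorem boundary_apply (Δ : PreAbstractSimplicialComplex V) (i j : ℤ) (a : Δ.Chain i)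
    (y : Δ.SimplexOfDim j) : Δ.boundary i j a y = ∑ x : Δ.SimplexOfDim i,
      if y.1 ≤ x.1 ∧ x.1.1.card = y.1.1.card + 1 then simplexSign x.1.1 y.1.1 * a x else 0 := by
  simp only [boundary, LinearMap.pi_apply, LinearMap.sum_apply]
  refine sum_congr rfl fun x _ => ?_
  split_ifs <;> simp

theorem chainEquiv_boundary (Δ : PreAbstractSimplicialComplex V) {i j : ℤ} (hij : i = j + 1)
    (a : Δ.Chain i) : ((Δ.chainEquiv j (Δ.boundary i j a)).1 : Finset V → ℝ) =
      bd (Δ.chainEquiv i a).1 := by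
  funext y
  by_cases h : y ∈ Δ.simplexSet ∧ (y.card : ℤ) = j + 1
  · rw [Δ.chainEquiv_apply j _ ⟨⟨y, h.1⟩, h.2⟩, boundary_apply]
    refine sum_cofaces (fun x : Δ.SimplexOfDim i => x.1.1)
      (fun _ _ h => Subtype.ext (Subtype.ext h)) y _ (fun t ht => ?_) _ (fun x hx => ?_)
      (fun x hx => if_neg hx)
    · obtain ⟨h1, h2⟩ := mem_chains_of_ne (Δ.chainEquiv i a).2 ht
      exact ⟨⟨⟨t, h1⟩, h2⟩, rfl⟩
    · rw [chainEquiv_apply]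
      exact if_pos hx
  · rw [(Δ.chainEquiv j _).2 y h]
    by_contra hne
    obtain ⟨v, hv, hne⟩ := exists_ne_of_bd_ne (Ne.symm hne)
    obtain ⟨h1, h2⟩ := mem_chains_of_ne (Δ.chainEquiv i a).2 hne
    rw [card_insert_of_notMem hv] at h2
    push_cast at h2
    exact h ⟨Δ.isLowerSet_simplexSet (subset_insert v y) h1, by omega⟩

/-- The sign by which the chains of the link of `x` are twisted. -/
def linkSign (x t : Finset V) : ℝ := ∏ v ∈ t, sg v x

omit [Fintype V] in
theorem linkSign_mul_self (x t : Finset V) : linkSign x t * linkSign x t = 1 := by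
  rw [linkSign, ← prod_mul_distrib]
  exact prod_eq_one fun v _ => sg_mul_self v x

open Classical in
/-- Chains of the link of `x` as chains on the simplices containing `x`. -/
noncomputable def linkEquiv (Δ : PreAbstractSimplicialComplex V) {x : Finset V}
    (hx : x ∈ Δ.simplexSet) (m : ℤ) :
    chains (Δ.link x).simplexSet m ≃ₗ[ℝ] chains (Δ.simplexSet ∩ Set.Ici x) (m + x.card) where
  toFun f := ⟨fun y => if x ⊆ y then linkSign x (y \ x) * f.1 (y \ x) else 0, by
    intro y hy
    beta_reduce
    split_ifs with h
    · rw [f.2, mul_zero]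
      rintro ⟨h1, h2⟩
      rw [mem_simplexSet_link Δ hx, sdiff_union_of_subset h] at h1
      refine hy ⟨⟨h1.2, h⟩, ?_⟩
      have := card_sdiff_add_card_eq_card h
      omega
    · rfl⟩
  map_add' f g := by
    refine Subtype.ext (funext fun y => ?_)
    by_cases h : x ⊆ y <;> simp [h, mul_add]
  map_smul' c f := by
    refine Subtype.ext (funext fun y => ?_)
    by_cases h : x ⊆ y
    · simp [h]; ring
    · simp [h]
  invFun g := ⟨fun t => if Disjoint t x then linkSign x t * g.1 (t ∪ x) else 0, by
    intro t ht
    beta_reduce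
    split_ifs with h
    · rw [g.2, mul_zero]
      rintro ⟨⟨h1, -⟩, h2⟩
      refine ht ⟨(mem_simplexSet_link Δ hx).mpr ⟨h, h1⟩, ?_⟩
      rw [card_union_of_disjoint h] at h2
      push_cast at h2
      omega
    · rfl⟩
  left_inv f := by
    refine Subtype.ext (funext fun t => ?_)
    by_cases h : Disjoint t x
    · simp only [h, if_true, subset_union_right, union_sdiff_cancel_right h]
      rw [← mul_assoc, linkSign_mul_self, one_mul]
    · simp only [h, if_false]
      exact (f.2 t fun ht => h ((mem_simplexSet_link Δ hx).mp ht.1).1).symm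
  right_inv g := by
    refine Subtype.ext (funext fun y => ?_)
    by_cases h : x ⊆ y
    · simp only [h, if_true, sdiff_disjoint, sdiff_union_of_subset]
      rw [← mul_assoc, linkSign_mul_self, one_mul]
    · simp only [h, if_false]
      exact (g.2 y fun hy => h hy.1.2).symm

/-- The sign of v in y splits as `sg v x * sg v (y \ x)`; adding v to the link simplex changes
`linkSign` by the first factor, which cancels. Vertices of x contribute nothing in the link. -/
theorem linkEquiv_bd (Δ : PreAbstractSimplicialComplex V) {x : Finset V} (hx : x ∈ Δ.simplexSet)
    {m m' : ℤ} (f : chains (Δ.link x).simplexSet m) (g : chains (Δ.link x).simplexSet m')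
    (hg : g.1 = bd f.1) {y : Finset V} (hy : x ⊆ y) :
    (Δ.linkEquiv hx m' g).1 y = bd (Δ.linkEquiv hx m f).1 y := by
  have h1 : (Δ.linkEquiv hx m' g).1 y = linkSign x (y \ x) * g.1 (y \ x) := if_pos hy
  have h2 : ∀ v ∈ yᶜ, sg v y * (Δ.linkEquiv hx m f).1 (insert v y) =
      linkSign x (y \ x) * (sg v (y \ x) * f.1 (insert v (y \ x))) := by
    intro v hv
    have hvy := mem_compl.mp hv
    have hvx : v ∉ x := fun h => hvy (hy h)
    have h3 : (Δ.linkEquiv hx m f).1 (insert v y) =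
        linkSign x (insert v y \ x) * f.1 (insert v y \ x) :=
      if_pos (hy.trans (subset_insert v y))
    have h4 : sg v y = sg v x * sg v (y \ x) := by
      rw [← sg_union disjoint_sdiff, union_sdiff_of_subset hy]
    rw [h3, insert_sdiff_of_notMem _ hvx, linkSign, prod_insert (fun h => hvy (mem_sdiff.mp h).1),
      h4, linkSign]
    linear_combination (sg v (y \ x) * (∏ v ∈ y \ x, sg v x) * f.1 (insert v (y \ x))) *
      sg_mul_self v x
  rw [h1, hg, bd_apply, bd_apply, sum_congr rfl h2, ← mul_sum]
  congr 1
  refine (sum_subset (compl_subset_compl.mpr sdiff_subset) fun v hv hvy => ?_).symm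
  have hvx : v ∈ x := by
    by_contra h
    exact mem_compl.mp hv (mem_sdiff.mpr ⟨by simpa using hvy, h⟩)
  rw [f.2, mul_zero]
  exact fun h => disjoint_left.mp ((mem_simplexSet_link Δ hx).mp h.1).1 (mem_insert_self v _) hvx

/-- Simplicial chains of the link of `x` as chains on the simplices containing `x`. -/
noncomputable def linkChainEquiv (Δ : PreAbstractSimplicialComplex V) {x : Finset V}
    (hx : x ∈ Δ.simplexSet) (i : ℤ) :
    (Δ.link x).Chain i ≃ₗ[ℝ] chains (Δ.simplexSet ∩ Set.Ici x) (i + 1 + x.card) :=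
  ((Δ.link x).chainEquiv i).trans (Δ.linkEquiv hx (i + 1))

theorem linkChainEquiv_boundary (Δ : PreAbstractSimplicialComplex V) {x : Finset V}
    (hx : x ∈ Δ.simplexSet) {i j : ℤ} (hij : i = j + 1) (a : (Δ.link x).Chain i)
    (y : Finset V) (hy : y ∈ Δ.simplexSet ∩ Set.Ici x) :
    (Δ.linkChainEquiv hx j ((Δ.link x).boundary i j a) : Finset V → ℝ) y =
      bd (Δ.linkChainEquiv hx i a) y :=
  Δ.linkEquiv_bd hx _ _ ((Δ.link x).chainEquiv_boundary hij a) hy.2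

theorem subsingleton_reducedHomology_link_iff (Δ : PreAbstractSimplicialComplex V) {x : Finset V}
    (hx : x ∈ Δ.simplexSet) (i : ℤ) : Subsingleton ((Δ.link x).ReducedHomology i) ↔
      ExactAt (Δ.simplexSet ∩ Set.Ici x) (i + 1 + x.card) :=
  subsingleton_homology_iff_exactAt (Δ.linkChainEquiv hx (i + 1)) (Δ.linkChainEquiv hx i)
    (Δ.linkChainEquiv hx (i - 1)) (by ring) (Δ.linkChainEquiv_boundary hx rfl)
    (Δ.linkChainEquiv_boundary hx (by ring))

theorem nonempty_reducedHomology_link_equiv_iff (Δ : PreAbstractSimplicialComplex V)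
    {x : Finset V} (hx : x ∈ Δ.simplexSet) {i : ℤ} (hi : i = Δ.rank - x.card - 1) :
    Nonempty ((Δ.link x).ReducedHomology i ≃ₗ[ℝ] ℝ) ↔
      ∃ u, IsGenerator (cycles (Δ.simplexSet ∩ Set.Ici x) Δ.rank) u := by
  have e := topEquiv (d₂ := (Δ.link x).boundary (i + 1) i) (fun y hy => Δ.card_le_rank hy.1)
    (by omega) (Δ.linkChainEquiv hx (i + 1)) (Δ.linkChainEquiv hx i)
    (Δ.linkChainEquiv hx (i - 1)) (Δ.linkChainEquiv_boundary hx (by ring))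
  rw [show i + 1 + (x.card : ℤ) = Δ.rank by omega] at e
  rw [← nonempty_equiv_real_iff]
  exact ⟨fun ⟨h⟩ => ⟨e.symm.trans h⟩, fun ⟨h⟩ => ⟨e.trans h⟩⟩

end PreAbstractSimplicialComplex

/-! ### The dual of the constant sheaf -/

namespace PosetSheaf

open SetChain

section Restrict

variable {P : Type*} [PartialOrder P]

/-- This lets the sphere be treated as the case S = `Set.univ` of the argument for ℝ_S. -/
theorem nonempty_iso_restrict_univ_iff (F G : PosetSheaf P) :
    Nonempty (Iso F (G.restrict Set.univ)) ↔ Nonempty (Iso F G) := by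
  have htop : ∀ p, G.stalkOn Set.univ p = ⊤ := fun p => by
    rw [eq_top_iff]
    exact fun a _ hn => absurd (Set.mem_univ p) hn
  constructor
  · rintro ⟨e⟩
    refine ⟨⟨fun p => (e.app p).trans (LinearEquiv.ofTop _ (htop p)), fun {p q} h a => ?_⟩⟩
    change ((e.app q (F.res h a)).1 : G.stalk q) = G.res h (e.app p a).1
    rw [e.comm h a]
    exact G.coe_resOn_of_mem Set.univ h (Set.mem_univ q) _
  · rintro ⟨e⟩
    refine ⟨⟨fun p => (e.app p).trans (LinearEquiv.ofTop _ (htop p)).symm, fun {p q} h a => ?_⟩⟩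
    refine Subtype.ext ?_
    refine Eq.trans ?_ (G.coe_resOn_of_mem Set.univ h (Set.mem_univ q) _).symm
    exact e.comm h a

end Restrict

variable {V : Type*} [Fintype V] {Δ : PreAbstractSimplicialComplex V}

open Classical in
/-- Cochains of the constant sheaf on `[x, 1̂)` as functions of all finite sets. -/
noncomputable def cochainEquiv (x : Δ.Simplex) (k m : ℤ) (hm : m = Δ.rank - k) :
    ((const Δ.Simplex).restrict (Set.Ici x)).Cochain k ≃ₗ[ℝ]
      chains (Δ.simplexSet ∩ Set.Ici x.1) m where
  toFun a := ⟨fun y => if h : y ∈ Δ.simplexSet ∧ (y.card : ℤ) = Δ.rank - k then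
    (a ⟨⟨y, h.1⟩, h.2⟩).1 else 0, by
      intro y hy
      by_cases h : y ∈ Δ.simplexSet ∧ (y.card : ℤ) = Δ.rank - k
      · refine (dif_pos h).trans ((a ⟨⟨y, h.1⟩, h.2⟩).2 fun hxy => hy ⟨⟨h.1, hxy⟩, ?_⟩)
        rw [h.2, hm]
      · exact dif_neg h⟩
  map_add' a b := by
    refine Subtype.ext (funext fun y => ?_)
    by_cases h : y ∈ Δ.simplexSet ∧ (y.card : ℤ) = Δ.rank - k <;> simp [h]
  map_smul' c a := by
    refine Subtype.ext (funext fun y => ?_)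
    by_cases h : y ∈ Δ.simplexSet ∧ (y.card : ℤ) = Δ.rank - k <;> simp [h]
  invFun f y := ⟨f.1 y.1.1, fun h => f.2 _ fun h' => h h'.1.2⟩
  left_inv a := by
    funext y
    exact Subtype.ext (dif_pos (show y.1.1 ∈ Δ.simplexSet ∧ _ from ⟨y.1.2, y.2⟩))
  right_inv f := by
    refine Subtype.ext (funext fun y => ?_)
    by_cases h : y ∈ Δ.simplexSet ∧ (y.card : ℤ) = Δ.rank - k
    · simp [h]
    · simp only [h, dif_neg, not_false_eq_true]
      exact (f.2 y fun h' => h ⟨h'.1.1, h'.2.trans hm⟩).symm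

theorem cochainEquiv_apply (x : Δ.Simplex) (k m : ℤ) (hm : m = Δ.rank - k)
    (a : ((const Δ.Simplex).restrict (Set.Ici x)).Cochain k) (y : Δ.SimplexOfCodeg k) :
    (cochainEquiv x k m hm a : Finset V → ℝ) y.1.1 = (a y).1 :=
  dif_pos (show y.1.1 ∈ Δ.simplexSet ∧ _ from ⟨y.1.2, y.2⟩)

variable [LinearOrder V]

theorem cochainEquiv_differential (x : Δ.Simplex) {k l : ℤ} (m m' : ℤ) (hm : m = Δ.rank - k)
    (hm' : m' = Δ.rank - l) (hkl : l = k + 1)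
    (a : ((const Δ.Simplex).restrict (Set.Ici x)).Cochain k) (y : Finset V)
    (hy : y ∈ Δ.simplexSet ∩ Set.Ici x.1) :
    (cochainEquiv x l m' hm'
      (((const Δ.Simplex).restrict (Set.Ici x)).differential k l a) : Finset V → ℝ) y =
      bd (cochainEquiv x k m hm a) y := by
  by_cases h : (y.card : ℤ) = Δ.rank - l
  · have hxy : x ≤ (⟨y, hy.1⟩ : Δ.Simplex) := hy.2
    obtain ⟨y', rfl⟩ : ∃ y' : Δ.SimplexOfCodeg l, y'.1.1 = y := ⟨⟨⟨y, hy.1⟩, h⟩, rfl⟩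
    rw [cochainEquiv_apply x l m' hm' _ y', differential_apply, ← Submodule.subtype_apply, map_sum]
    refine sum_cofaces (fun z : Δ.SimplexOfCodeg k => z.1.1)
      (fun _ _ h => Subtype.ext (Subtype.ext h)) y'.1.1 _ (fun t ht => ?_) _ (fun z hz => ?_)
      (fun z hz => ?_)
    · obtain ⟨h1, h2⟩ := mem_chains_of_ne (cochainEquiv x k m hm a).2 ht
      exact ⟨⟨⟨t, h1.1⟩, h2.trans hm⟩, rfl⟩
    · have hz' : y'.1 ≤ z.1 ∧ z.1.1.card = y'.1.1.card + 1 := hz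
      rw [dif_pos hz', map_smul, cochainEquiv_apply, smul_eq_mul]
      congr 1
      exact coe_resOn_of_mem (const Δ.Simplex) (Set.Ici x) hz'.1 hxy (a z)
    · have hz' : ¬ (y'.1 ≤ z.1 ∧ z.1.1.card = y'.1.1.card + 1) := hz
      rw [dif_neg hz', map_zero]
  · rw [(cochainEquiv x l m' hm' _).2 y fun h' => h (h'.2.trans hm')]
    by_contra hne
    obtain ⟨v, hv, hne⟩ := exists_ne_of_bd_ne (Ne.symm hne)
    have h2 := (mem_chains_of_ne (cochainEquiv x k m hm a).2 hne).2
    rw [Finset.card_insert_of_notMem hv] at h2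
    push_cast at h2
    omega

/-- Cellular degree i corresponds to cardinality n - i, so i > 0 becomes m < n. -/
theorem isCohenMacaulay_const_iff :
    (const Δ.Simplex).IsCohenMacaulay ↔ HasTopHomology Δ.simplexSet Δ.rank := by
  have key : ∀ (x : Δ.Simplex) (i : ℤ),
      Subsingleton (((const Δ.Simplex).restrict (Set.Ici x)).Cohomology i) ↔
        ExactAt (Δ.simplexSet ∩ Set.Ici x.1) (Δ.rank - i) := fun x i =>
    subsingleton_homology_iff_exactAt (cochainEquiv x (i - 1) _ rfl) (cochainEquiv x i _ rfl)
      (cochainEquiv x (i + 1) _ rfl) (by ring)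
      (cochainEquiv_differential x _ _ rfl rfl (by ring))
      (cochainEquiv_differential x _ _ rfl rfl rfl)
  constructor
  · intro h x hx m hm
    have := (key ⟨x, hx⟩ (Δ.rank - m)).mp (h ⟨x, hx⟩ _ (by omega))
    rwa [sub_sub_cancel] at this
  · intro h x i hi
    exact (key x i).mpr (h x.1 x.2 _ (by omega))

/-- The top cohomology of the constant sheaf on `[x, 1̂)` consists of cycles of facets. -/
noncomputable def cohomologyEquiv (x : Δ.Simplex) :
    ((const Δ.Simplex).restrict (Set.Ici x)).Cohomology 0 ≃ₗ[ℝ]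
      cycles (Δ.simplexSet ∩ Set.Ici x.1) Δ.rank :=
  topEquiv (fun _ hy => Δ.card_le_rank hy.1) (by omega) (cochainEquiv x (0 - 1) _ rfl)
    (cochainEquiv x 0 Δ.rank (by ring)) (cochainEquiv x (0 + 1) _ rfl)
    (cochainEquiv_differential x _ _ _ rfl rfl)

/-- In terms of cycles, the restriction maps of the dual sheaf are the transposes of `cut`. -/
theorem cohomologyEquiv_projH {x y : Δ.Simplex} (hxy : x ≤ y)
    (c : ((const Δ.Simplex).restrict (Set.Ici x)).Cohomology 0) :
    (cohomologyEquiv y ((const Δ.Simplex).projH hxy c) : Finset V → ℝ) =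
      cut y.1 (cohomologyEquiv x c) := by
  obtain ⟨f, rfl⟩ := Submodule.Quotient.mk_surjective _ c
  funext z
  change (cochainEquiv y 0 Δ.rank (by ring) (cochainMap ((const Δ.Simplex).proj hxy) 0 f.1) :
    Finset V → ℝ) z = cut y.1 (cochainEquiv x 0 Δ.rank (by ring) f.1) z
  by_cases hz : z ∈ Δ.simplexSet ∧ (z.card : ℤ) = Δ.rank - 0
  · rw [cochainEquiv_apply y 0 _ _ _ ⟨⟨z, hz.1⟩, hz.2⟩, cochainMap_apply]
    change ((const Δ.Simplex).projOn hxy ⟨z, hz.1⟩ (f.1 ⟨⟨z, hz.1⟩, hz.2⟩)).1 = _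
    by_cases hyz : y.1 ⊆ z
    · rw [cut_of_subset hyz, cochainEquiv_apply x 0 _ _ _ ⟨⟨z, hz.1⟩, hz.2⟩]
      exact coe_projOn_of_le (const Δ.Simplex) hxy (p := ⟨z, hz.1⟩) hyz _
    · rw [cut_of_not_subset hyz, projOn_of_not_le (const Δ.Simplex) hxy (p := ⟨z, hz.1⟩) hyz]
      rfl
  · have h1 : ∀ (w : Δ.Simplex) (a : chains (Δ.simplexSet ∩ Set.Ici w.1) (Δ.rank : ℤ)),
        (a : Finset V → ℝ) z = 0 := fun w a =>
      a.2 z fun h => hz ⟨h.1.1, by rw [h.2, sub_zero]⟩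
    rw [h1]
    by_cases hyz : y.1 ⊆ z
    · rw [cut_of_subset hyz, h1]
    · rw [cut_of_not_subset hyz]

instance (x : Δ.Simplex) :
    Module.Finite ℝ (((const Δ.Simplex).restrict (Set.Ici x)).Cohomology 0) :=
  Module.Finite.equiv (cohomologyEquiv x).symm

theorem exists_forall_dual_apply_eq {M : Type*} [AddCommGroup M] [Module ℝ M] [Module.Finite ℝ M]
    (ε : Module.Dual ℝ M →ₗ[ℝ] ℝ) : ∃ c : M, ∀ φ : Module.Dual ℝ M, ε φ = φ c := by
  refine ⟨(Module.evalEquiv ℝ M).symm ε, fun φ => ?_⟩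
  rw [Module.apply_evalEquiv_symm_apply]

theorem eq_of_forall_dual_apply_eq {M : Type*} [AddCommGroup M] [Module ℝ M] {a b : M}
    (h : ∀ φ : Module.Dual ℝ M, φ a = φ b) : a = b := by
  rw [← sub_eq_zero, ← Module.forall_dual_apply_eq_zero_iff ℝ]
  intro φ
  rw [map_sub, h, sub_self]

theorem exists_isGenerator_of_dual_equiv {M E : Type*} [AddCommGroup M] [Module ℝ M]
    [Module.Finite ℝ M] [AddCommGroup E] [Module ℝ E] {N : Submodule ℝ E} (θ : M ≃ₗ[ℝ] N)
    (ε : Module.Dual ℝ M →ₗ[ℝ] ℝ) (hε : Function.Bijective ε) {c : M}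
    (hc : ∀ φ : Module.Dual ℝ M, ε φ = φ c) : IsGenerator N (θ c : E) := by
  have hM : Module.finrank ℝ M = 1 := by
    rw [← Subspace.dual_finrank_eq, (LinearEquiv.ofBijective ε hε).finrank_eq,
      Module.finrank_self]
  obtain ⟨u, hu⟩ := (nonempty_equiv_real_iff N).mp
    ⟨θ.symm.trans (LinearEquiv.ofFinrankEq M ℝ (hM.trans (Module.finrank_self ℝ).symm))⟩
  refine hu.of_mem (θ c).2 fun h0 => ?_
  rw [Submodule.coe_eq_zero, map_eq_zero_iff _ θ.injective] at h0
  obtain ⟨φ, hφ⟩ := hε.2 1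
  rw [hc, h0, map_zero] at hφ
  exact zero_ne_one hφ

variable {S : Set Δ.Simplex} [S.OrdConnected] {T : Set (Finset V)}

/-- By finite-dimensional biduality, the isomorphism at x is evaluation at some `c x` in H^0.
Commutation with restriction says that `c x` projects to `c y` for x ∈ S, so these classes are
restrictions of a single chain. -/
theorem exists_isFundamentalClass_of_iso (hT : ∀ x : Δ.Simplex, x ∈ S ↔ x.1 ∈ T)
    (e : Iso (const Δ.Simplex).dual ((const Δ.Simplex).restrict S)) :
    ∃ ζ, IsFundamentalClass Δ.simplexSet Δ.rank T ζ := by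
  classical
  let ε (x : Δ.Simplex) :
      Module.Dual ℝ (((const Δ.Simplex).restrict (Set.Ici x)).Cohomology 0) →ₗ[ℝ] ℝ :=
    ((const Δ.Simplex).stalkOn S x).subtype ∘ₗ (e.app x).toLinearMap
  choose c hc using fun x => exists_forall_dual_apply_eq (ε x)
  have hproj : ∀ x y (hxy : x ≤ y), x ∈ S → (const Δ.Simplex).projH hxy (c x) = c y := by
    intro x y hxy hx
    refine eq_of_forall_dual_apply_eq fun φ => ?_
    have h1 := hc x (((const Δ.Simplex).projH hxy).dualMap φ)
    rw [LinearMap.dualMap_apply] at h1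
    rw [← h1, ← hc y]
    have h2 := e.comm hxy φ
    exact (congrArg Subtype.val h2).trans
      (coe_resOn_of_mem (const Δ.Simplex) S hxy hx (e.app y φ))
  -- The glued chain takes its value at a facet z from the class `c` of z itself, to which every `c
  -- x` with x ∈ S and x ≤ z projects.
  let ζ : Finset V → ℝ := fun z =>
    if h : z ∈ Δ.simplexSet ∧ (z.card : ℤ) = Δ.rank then
      (cohomologyEquiv ⟨z, h.1⟩ (c ⟨z, h.1⟩) : Finset V → ℝ) z else 0
  have hcut : ∀ x : Δ.Simplex, x ∈ S → cut x.1 ζ = (cohomologyEquiv x (c x) : Finset V → ℝ) := by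
    intro x hx
    funext z
    by_cases hxz : x.1 ⊆ z
    · rw [cut_of_subset hxz]
      by_cases hz : z ∈ Δ.simplexSet ∧ (z.card : ℤ) = Δ.rank
      · have h1 := cohomologyEquiv_projH (x := x) (y := ⟨z, hz.1⟩) hxz (c x)
        rw [hproj x ⟨z, hz.1⟩ hxz hx] at h1
        have h2 := congrFun h1 z
        rw [cut_of_subset (subset_refl z)] at h2
        rw [← h2]
        exact dif_pos hz
      · rw [(cohomologyEquiv x (c x)).2.1 z fun h => hz ⟨h.1.1, h.2⟩]
        exact dif_neg hz
    · rw [cut_of_not_subset hxz, (cohomologyEquiv x (c x)).2.1 z fun h => hxz h.1.2]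
  refine ⟨ζ, fun z hz => dif_neg hz, fun x hx hxT => ?_, fun x hx hxT f hf => ?_⟩
  · have hxS := (hT ⟨x, hx⟩).mpr hxT
    rw [hcut ⟨x, hx⟩ hxS]
    refine exists_isGenerator_of_dual_equiv (cohomologyEquiv ⟨x, hx⟩) (ε ⟨x, hx⟩)
      ⟨fun φ ψ h => (e.app ⟨x, hx⟩).injective (Subtype.ext h), fun r => ?_⟩ (hc ⟨x, hx⟩)
    obtain ⟨φ, hφ⟩ := (e.app ⟨x, hx⟩).surjective ⟨r, fun h => absurd hxS h⟩
    exact ⟨φ, congrArg Subtype.val hφ⟩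
  · have hxS : (⟨x, hx⟩ : Δ.Simplex) ∉ S := fun h => hxT ((hT ⟨x, hx⟩).mp h)
    have h0 : (cohomologyEquiv ⟨x, hx⟩).symm ⟨f, hf⟩ = 0 := by
      refine eq_of_forall_dual_apply_eq fun φ => ?_
      have hφ : φ = 0 := (e.app ⟨x, hx⟩).injective
        (Subtype.ext (((e.app ⟨x, hx⟩ φ).2 hxS).trans ((e.app ⟨x, hx⟩ 0).2 hxS).symm))
      rw [hφ, LinearMap.zero_apply, LinearMap.zero_apply]
    have h1 := (map_eq_zero_iff _ (cohomologyEquiv ⟨x, hx⟩).symm.injective).mp h0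
    exact congrArg Subtype.val h1

/-- The isomorphism is evaluation at the restriction of ζ. It is bijective since that restriction is
a basis of H^0 for x ∈ S, and H^0 = 0 otherwise; naturality is `cut_cut`. -/
theorem nonempty_iso_of_isFundamentalClass (hT : ∀ x : Δ.Simplex, x ∈ S ↔ x.1 ∈ T)
    (hS : ∀ x ∈ S, ∀ y, x ≤ y → y ∈ S) {ζ : Finset V → ℝ}
    (hζ : IsFundamentalClass Δ.simplexSet Δ.rank T ζ) :
    Nonempty (Iso (const Δ.Simplex).dual ((const Δ.Simplex).restrict S)) := by
  classical
  have hgen : ∀ x : Δ.Simplex, x ∈ S →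
      IsGenerator (cycles (Δ.simplexSet ∩ Set.Ici x.1) Δ.rank) (cut x.1 ζ) :=
    fun x hx => hζ.isGenerator x.1 x.2 ((hT x).mp hx)
  let c (x : Δ.Simplex) : ((const Δ.Simplex).restrict (Set.Ici x)).Cohomology 0 :=
    if h : x ∈ S then (cohomologyEquiv x).symm ⟨cut x.1 ζ, (hgen x h).1⟩ else 0
  have hc : ∀ x, x ∈ S → (cohomologyEquiv x (c x) : Finset V → ℝ) = cut x.1 ζ := by
    intro x hx
    simp only [c, hx, dif_pos, LinearEquiv.apply_symm_apply]
  let ε (x : Δ.Simplex) :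
      Module.Dual ℝ (((const Δ.Simplex).restrict (Set.Ici x)).Cohomology 0) →ₗ[ℝ]
        (const Δ.Simplex).stalkOn S x :=
    (Module.Dual.eval ℝ _ (c x)).codRestrict ((const Δ.Simplex).stalkOn S x) fun φ hx => by
      simp only [c, hx, dif_neg, not_false_eq_true, map_zero]
      rfl
  have hε : ∀ x φ, (ε x φ).1 = φ (c x) := fun _ _ => rfl
  have hbij : ∀ x, Function.Bijective (ε x) := by
    intro x
    by_cases hx : x ∈ S
    · constructor
      · intro φ ψ h
        have h1 : φ (c x) = ψ (c x) := congrArg Subtype.val h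
        refine LinearMap.ext fun m => ?_
        obtain ⟨r, hr⟩ := (hgen x hx).2.2 _ (cohomologyEquiv x m).2
        have h2 : m = r • c x := by
          refine (cohomologyEquiv x).injective (Subtype.ext ?_)
          rw [map_smul, hr, ← hc x hx]; rfl
        rw [h2, map_smul, map_smul, h1]
      · intro a
        have hc0 : c x ≠ 0 := by
          intro h0
          refine (hgen x hx).2.1 ?_
          rw [← hc x hx, h0, map_zero]; rfl
        obtain ⟨φ, hφ⟩ : ∃ φ : Module.Dual ℝ _, φ (c x) ≠ 0 := by
          by_contra! h
          exact hc0 ((Module.forall_dual_apply_eq_zero_iff ℝ _).mp h)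
        refine ⟨((a.1 : ℝ) / φ (c x)) • φ, Subtype.ext ?_⟩
        rw [hε, LinearMap.smul_apply, smul_eq_mul]
        exact div_mul_cancel₀ _ hφ
    · constructor
      · intro φ ψ _
        refine LinearMap.ext fun m => ?_
        have h0 := hζ.eq_zero x.1 x.2 (fun h => hx ((hT x).mpr h)) _ (cohomologyEquiv x m).2
        rw [Submodule.coe_eq_zero, map_eq_zero_iff _ (cohomologyEquiv x).injective] at h0
        rw [h0, map_zero, map_zero]
      · intro a
        exact ⟨0, Subtype.ext (((ε x 0).2 hx).trans (a.2 hx).symm)⟩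
  refine ⟨⟨fun x => LinearEquiv.ofBijective (ε x) (hbij x), fun {p q} h φ => ?_⟩⟩
  by_cases hq : q ∈ S
  · have hproj : (const Δ.Simplex).projH h (c q) = c p := by
      refine (cohomologyEquiv p).injective (Subtype.ext ?_)
      rw [cohomologyEquiv_projH, hc q hq, hc p (hS q hq p h)]
      exact cut_cut h ζ
    refine Subtype.ext (Eq.trans ?_
      (coe_resOn_of_mem (const Δ.Simplex) S h hq (ε p φ)).symm)
    change φ ((const Δ.Simplex).projH h (c q)) = φ (c p)
    rw [hproj]
  · exact Subtype.ext (((ε q _).2 hq).trans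
      (((const Δ.Simplex).resOn S h (ε p φ)).2 hq).symm)

end PosetSheaf

/-! ### Spheres and balls in terms of top cycles, and the theorem. -/

namespace PreAbstractSimplicialComplex

open SetChain

variable {V : Type*} [Fintype V] [LinearOrder V]

theorem exactAt_of_rank_lt (Δ : PreAbstractSimplicialComplex V) (x : Finset V) {m : ℤ}
    (hm : (Δ.rank : ℤ) < m) : ExactAt (Δ.simplexSet ∩ Set.Ici x) m :=
  exactAt_of_forall_card_ne fun y hy h => by
    have := Δ.card_le_rank hy.1
    omega

theorem isGorenstein_iff (Δ : PreAbstractSimplicialComplex V) :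
    Δ.IsGorenstein ↔ HasTopHomology Δ.simplexSet Δ.rank ∧
      ∀ x ∈ Δ.simplexSet, ∃ u, IsGenerator (cycles (Δ.simplexSet ∩ Set.Ici x) Δ.rank) u := by
  constructor
  · refine fun h => ⟨fun x hx m hm => ?_, fun x hx => ?_⟩
    · have h1 := h ⟨x, hx⟩ (m - 1 - x.card)
      rw [if_neg (by dsimp only; omega), subsingleton_reducedHomology_link_iff Δ hx] at h1
      convert h1 using 1
      ring
    · have h1 := h ⟨x, hx⟩ (Δ.rank - x.card - 1)
      rw [if_pos rfl] at h1
      exact (nonempty_reducedHomology_link_equiv_iff Δ hx rfl).mp h1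
  · rintro ⟨h1, h2⟩ x i
    split_ifs with hi
    · exact (nonempty_reducedHomology_link_equiv_iff Δ x.2 hi).mpr (h2 x.1 x.2)
    · rw [subsingleton_reducedHomology_link_iff Δ x.2]
      rcases lt_or_ge (i + 1 + (x.1.card : ℤ)) Δ.rank with hlt | hge
      · exact h1 x.1 x.2 _ hlt
      · exact Δ.exactAt_of_rank_lt x.1 (by omega)

theorem isNearGorenstein_iff (Δ D : PreAbstractSimplicialComplex V) (hD : D ≤ Δ)
    (hrank : D.rank + 1 = Δ.rank) :
    Δ.IsNearGorenstein D ↔ D.IsGorenstein ∧ HasTopHomology Δ.simplexSet Δ.rank ∧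
      (∀ x ∈ Δ.simplexSet, x ∈ D.simplexSetᶜ →
        ∃ u, IsGenerator (cycles (Δ.simplexSet ∩ Set.Ici x) Δ.rank) u) ∧
      ∀ x ∈ Δ.simplexSet, x ∉ D.simplexSetᶜ →
        ∀ f ∈ cycles (Δ.simplexSet ∩ Set.Ici x) Δ.rank, f = 0 := by
  constructor
  · rintro ⟨-, ⟨-, hG⟩, h⟩
    refine ⟨hG, fun x hx m hm => ?_, fun x hx hxD => ?_, fun x hx hxD f hf => ?_⟩
    · have h1 := h ⟨x, hx⟩ (m - 1 - x.card)
      rw [if_neg (by dsimp only; omega), subsingleton_reducedHomology_link_iff Δ hx] at h1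
      convert h1 using 1
      ring
    · have h1 := h ⟨x, hx⟩ (Δ.rank - x.card - 1)
      rw [if_pos ⟨rfl, hxD⟩] at h1
      exact (nonempty_reducedHomology_link_equiv_iff Δ hx rfl).mp h1
    · have h1 := h ⟨x, hx⟩ (Δ.rank - x.card - 1)
      rw [if_neg fun h => hxD h.2, subsingleton_reducedHomology_link_iff Δ hx,
        show (Δ.rank : ℤ) - x.card - 1 + 1 + x.card = Δ.rank by ring] at h1
      -- In top degree exactness kills all cycles: the bounding chain has cardinality rank + 1,
      -- hence is zero.
      obtain ⟨g, hg, hgf⟩ := h1 f hf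
      have hg0 : g = 0 :=
        eq_zero_of_mem_chains (fun y hy => Δ.card_le_rank hy.1) (by omega) hg
      funext y
      by_cases hy : y ∈ Δ.simplexSet ∩ Set.Ici x
      · rw [← hgf y hy, hg0, map_zero]
      · exact hf.1 y fun h => hy h.1
  · rintro ⟨hG, h1, h2, h3⟩
    refine ⟨hD, ⟨hrank, hG⟩, fun x i => ?_⟩
    split_ifs with hi
    · exact (nonempty_reducedHomology_link_equiv_iff Δ x.2 hi.1).mpr (h2 x.1 x.2 hi.2)
    · rw [subsingleton_reducedHomology_link_iff Δ x.2]
      rcases lt_trichotomy (i + 1 + (x.1.card : ℤ)) Δ.rank with hlt | heq | hgt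
      · exact h1 x.1 x.2 _ hlt
      · rw [heq]
        exact exactAt_of_cycles_eq_zero (h3 x.1 x.2 fun h => hi ⟨by omega, h⟩)
      · exact Δ.exactAt_of_rank_lt x.1 hgt

omit [Fintype V] [LinearOrder V] in
theorem simplexSet_subset {D Δ : PreAbstractSimplicialComplex V} (h : D ≤ Δ) :
    D.simplexSet ⊆ Δ.simplexSet :=
  fun _ hx => hx.imp_right fun hx => h hx

/-- The boundary of a complex with a fundamental class is a homology sphere. -/
theorem isGorenstein_of_isFundamentalClass {Δ D : PreAbstractSimplicialComplex V} (hD : D ≤ Δ)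
    (hrank : D.rank + 1 = Δ.rank) (hCM : HasTopHomology Δ.simplexSet Δ.rank) {ζ : Finset V → ℝ}
    (hζ : IsFundamentalClass Δ.simplexSet Δ.rank D.simplexSetᶜ ζ) : D.IsGorenstein := by
  rw [isGorenstein_iff]
  refine ⟨fun x hx m hm => ?_, fun x hx => ⟨cut x (bd ζ), ?_⟩⟩
  · exact hζ.boundary_exactAt Δ.isLowerSet_simplexSet D.isLowerSet_simplexSet
      (simplexSet_subset hD) hCM hx (by omega)
  · exact hζ.boundary_isGenerator Δ.isLowerSet_simplexSet (fun _ => Δ.card_le_rank)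
      D.isLowerSet_simplexSet (simplexSet_subset hD) (fun _ => D.card_le_rank) hrank hCM hx

end PreAbstractSimplicialComplex

open SetChain PreAbstractSimplicialComplex PosetSheaf in
theorem mainTheorem10 {V : Type*} [Fintype V] [LinearOrder V]
    (Δ : PreAbstractSimplicialComplex V) :
    (Δ.IsGorenstein ↔
      (PosetSheaf.const Δ.Simplex).IsCohenMacaulay ∧
        Nonempty (PosetSheaf.Iso (PosetSheaf.const Δ.Simplex).dual
          (PosetSheaf.const Δ.Simplex))) ∧
    (∀ D : PreAbstractSimplicialComplex V, D ≤ Δ → D.rank + 1 = Δ.rank →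
      (Δ.IsNearGorenstein D ↔
        (PosetSheaf.const Δ.Simplex).IsCohenMacaulay ∧
          Nonempty (PosetSheaf.Iso (PosetSheaf.const Δ.Simplex).dual
            ((PosetSheaf.const Δ.Simplex).restrict (Δ.interior D))))) := by
  have hK := Δ.isLowerSet_simplexSet
  have hn : ∀ y ∈ Δ.simplexSet, y.card ≤ Δ.rank := fun _ => Δ.card_le_rank
  have h0 := Δ.empty_mem_simplexSet
  refine ⟨?_, fun D hD hrank => ?_⟩
  · rw [isGorenstein_iff, isCohenMacaulay_const_iff, ← nonempty_iso_restrict_univ_iff]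
    refine and_congr_right fun hCM => ⟨fun hgen => ?_, fun ⟨e⟩ x hx => ?_⟩
    -- The generator over the empty simplex is the fundamental class of the sphere.
    · obtain ⟨ζ, hζ⟩ := hgen ∅ h0
      exact nonempty_iso_of_isFundamentalClass (T := Set.univ) (fun x => by simp)
        (fun _ _ _ _ => Set.mem_univ _)
        (isFundamentalClass_of_generators hK hn hCM h0 (fun _ _ _ _ _ => Set.mem_univ _)
          (fun x hx _ => hgen x hx) (fun x _ h => absurd (Set.mem_univ x) h)
          (fun y hy => hζ.1.1 y fun h => hy ⟨h.1.1, h.2⟩) hζ.2.1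
          (fun y hy _ => hζ.1.2 y ⟨hy, Finset.empty_subset y⟩))
    · obtain ⟨ζ, hζ⟩ := exists_isFundamentalClass_of_iso (T := Set.univ) (fun x => by simp) e
      exact ⟨_, hζ.isGenerator x hx (Set.mem_univ x)⟩
  · have hT : ∀ x : Δ.Simplex, x ∈ Δ.interior D ↔ x.1 ∈ D.simplexSetᶜ := fun _ => Iff.rfl
    have hDl := D.isLowerSet_simplexSet
    rw [isNearGorenstein_iff Δ D hD hrank, isCohenMacaulay_const_iff]
    constructor
    · rintro ⟨hG, hCM, hgen, hzero⟩
      refine ⟨hCM, ?_⟩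
      -- The fundamental cycle `u` of the boundary sphere bounds in Δ, and the chain filling it is
      -- the fundamental class of the ball.
      obtain ⟨u, hu⟩ := ((isGorenstein_iff D).mp hG).2 ∅ D.empty_mem_simplexSet
      obtain ⟨ζ, hζ, hζ0, hbd⟩ := exists_relative_cycle hDl (simplexSet_subset hD)
        D.empty_mem_simplexSet hrank hCM hu.1 hu.2.1
      exact nonempty_iso_of_isFundamentalClass hT
        (fun x hx y hxy => compl_upward (K := Δ.simplexSet) hDl x.1 hx y.1 y.2 hxy)
        (isFundamentalClass_of_generators hK hn hCM h0 (compl_upward hDl) hgen hzero hζ hζ0 hbd)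
    · rintro ⟨hCM, ⟨e⟩⟩
      obtain ⟨ζ, hζ⟩ := exists_isFundamentalClass_of_iso hT e
      exact ⟨isGorenstein_of_isFundamentalClass hD hrank hCM hζ, hCM,
        fun x hx hxD => ⟨_, hζ.isGenerator x hx hxD⟩, hζ.eq_zero⟩
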